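/- Let $k\ge 2$ be an integer, let $\mathbb H$ be the upper half-plane and write $z=x+iy$. **Green's function.** For $\mathfrak z\in\mathbb H$ let $\omega_{\mathfrak z}$ be the order of the stabilizer of $\mathfrak z$ in $\mathrm{PSL}_2(\mathbb Z)$, and put $r_{\mathfrak z}(z):=\left|\frac{z-\mathfrak z}{z-\overline{\mathfrak z}}\right|$. The higher Green's function $G_k(z,\mathfrak z)=G_k^{\mathbb H/\mathrm{SL}_2(\mathbb Z)}(z,\mathfrak z)$ is the function, defined for $z,\mathfrak z\in\mathbb H$ that are not $\mathrm{SL}_2(\mathbb Z)$-equivalent, which is characterized by the following properties: it is real-valued and smooth; $G_k(\gamma_1 z,\gamma_2\mathfrak z)=G_k(z,\mathfrak z)$ for all $\gamma_1,\gamma_2\in\mathrm{SL}_2(\mathbb Z)$; with $\Delta_0=-y^2(\partial_x^2+\partial_y^2)$, $\Delta_{0,z}G_k=\Delta_{0,\mathfrak z}G_k=k(1-k)G_k$; for every $\mathfrak z$, $G_k(z,\mathfrak z)=2\omega_{\mathfrak z}\log r_{\mathfrak z}(z)+O(1)$ as $z\to\mathfrak z$; and, for every $\mathfrak z$, $G_k(z,\mathfrak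 z)\to0$ as $z$ approaches a cusp. **Raising.** Let $R_\kappa:=2i\frac{\partial}{\partial z}+\kappa y^{-1}$ and $R_0^{n}:=R_{2n-2}\circ\cdots\circ R_2\circ R_0$, acting in the variable $z$. **The function $\mathcal G_Q$.** Let $Q$ be a positive-definite integral binary quadratic form of discriminant $-D<0$, let $[Q]$ be its $\mathrm{SL}_2(\mathbb Z)$-equivalence class, and let $\tau_Q\in\mathbb H$ be the root of $Q(\cdot,1)$ in $\mathbb H$. For $\mathcal Q=[a,b,c]$ put $\mathcal Q_z:=y^{-1}(a|z|^2+bx+c)$, and $$\mathcal G_Q(z):=D^{\frac{1-k}2}\sum_{\mathcal Q\in[Q]}\mathcal Q(z,1)^{k-1}\int_0^{\operatorname{arctanh}\left(\sqrt D/\mathcal Q_z\right)}\sinh^{2k-2}(\theta)\,d\theta .$$ **Proposition.** The function $G_k$ exists. For every $Q$ as above and every $z\in\mathbb H$ which is not $\mathrm{SL}_2(\mathbb Z)$-equivalent to $\tau_Q$, the series defining $\mathcal G_Q(z)$ converges absolutely, and $$\mathcal G_Q(z)=-\frac{1}{2^k\,\omega_{\tau_Q}\,(k-1)!}\;y^{2k-2}\;\overline{R_0^{k-1}\bigl(G_k(z,\tau_Q)\bigr)}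 .$$ -/

import Mathlib

open UpperHalfPlane Filter Topology MatrixGroups ContDiff

noncomputable section

namespace HigherGreen

/-! ### Integral binary quadratic forms -/

/-- The integral binary quadratic form `[a, b, c] = a X ^ 2 + b X Y + c Y ^ 2`. -/
@[ext]
structure BinForm where
  a : ℤ
  b : ℤ
  c : ℤ

namespace BinForm

/-- The value `Q(X, Y)`. -/
def eval (Q : BinForm) (X Y : ℂ) : ℂ := Q.a * X ^ 2 + Q.b * X * Y + Q.c * Y ^ 2

/-- `D = 4 a c - b ^ 2`, that is, minus the discriminant of `Q`. -/
def negDisc (Q : BinForm) : ℤ := 4 * Q.a * Q.c - Q.b ^ 2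

/-- Positive definiteness: `a > 0` and negative discriminant. -/
def PosDef (Q : BinForm) : Prop := 0 < Q.a ∧ 0 < Q.negDisc

/-- The form `Q ∘ γ`, i.e. `(X, Y) ↦ Q(γ₀₀ X + γ₀₁ Y, γ₁₀ X + γ₁₁ Y)`. -/
def comp (Q : BinForm) (γ : SL(2, ℤ)) : BinForm where
  a := Q.a * γ 0 0 ^ 2 + Q.b * γ 0 0 * γ 1 0 + Q.c * γ 1 0 ^ 2
  b := 2 * Q.a * γ 0 0 * γ 0 1 + Q.b * (γ 0 0 * γ 1 1 + γ 0 1 * γ 1 0) + 2 * Q.c * γ 1 0 * γ 1 1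
  c := Q.a * γ 0 1 ^ 2 + Q.b * γ 0 1 * γ 1 1 + Q.c * γ 1 1 ^ 2

theorem eval_comp (Q : BinForm) (γ : SL(2, ℤ)) (X Y : ℂ) :
    (Q.comp γ).eval X Y = Q.eval (γ 0 0 * X + γ 0 1 * Y) (γ 1 0 * X + γ 1 1 * Y) := by
  simp only [eval, comp]
  push_cast
  ring

/-- The `SL₂(ℤ)`-equivalence class `[Q]`. -/
def equivClass (Q : BinForm) : Set BinForm := Set.range Q.comp

/-- `Q_z = y⁻¹ (a |z| ^ 2 + b x + c)` for `z = x + i y`. -/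
def atPoint (Q : BinForm) (z : ℍ) : ℝ :=
  z.im⁻¹ * (Q.a * ‖(z : ℂ)‖ ^ 2 + Q.b * z.re + Q.c)

/-- The CM point `τ_Q = (-b + i √D) / (2 a)`, the root of `Q(z, 1)` in the upper half-plane. -/
def cmPoint (Q : BinForm) (hQ : Q.PosDef) : ℍ :=
  ⟨⟨-Q.b / (2 * Q.a), √(Q.negDisc : ℝ) / (2 * Q.a)⟩, by
    have ha : (0 : ℝ) < Q.a := by exact_mod_cast hQ.1
    have hD : (0 : ℝ) < Q.negDisc := by exact_mod_cast hQ.2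
    have := Real.sqrt_pos.2 hD
    change 0 < √(Q.negDisc : ℝ) / (2 * Q.a)
    positivity⟩

theorem eval_cmPoint (Q : BinForm) (hQ : Q.PosDef) : Q.eval (Q.cmPoint hQ) 1 = 0 := by
  have ha : (Q.a : ℝ) ≠ 0 := by exact_mod_cast hQ.1.ne'
  have hD : (0 : ℝ) ≤ Q.negDisc := by exact_mod_cast hQ.2.le
  have hs : √(Q.negDisc : ℝ) ^ 2 = 4 * Q.a * Q.c - Q.b ^ 2 := by
    rw [Real.sq_sqrt hD]; simp [negDisc]
  have hz : ((Q.cmPoint hQ : ℍ) : ℂ)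
      = ⟨-Q.b / (2 * Q.a), √(Q.negDisc : ℝ) / (2 * Q.a)⟩ := rfl
  rw [hz]
  apply Complex.ext
  · simp [eval, pow_two]
    field_simp
    linear_combination (-1 : ℝ) * hs
  · simp [eval, pow_two]
    field_simp
    ring

end BinForm

/-- The summand of `𝒢_Q(z)` belonging to the form `P`, where `D` is minus its discriminant:
`P(z, 1) ^ (k - 1) ∫_0^{artanh (√D / P_z)} sinh ^ (2 k - 2) θ dθ`. -/
def calGTerm (k : ℕ) (D : ℤ) (z : ℍ) (P : BinForm) : ℂ :=
  P.eval z 1 ^ (k - 1) *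
    ((∫ θ in (0 : ℝ)..Real.artanh (√(D : ℝ) / P.atPoint z),
      Real.sinh θ ^ (2 * k - 2) : ℝ) : ℂ)

/-- `𝒢_Q(z) = D ^ ((1 - k) / 2) ∑_{P ∈ [Q]} P(z, 1) ^ (k - 1) ∫ ...`. -/
def calG (k : ℕ) (Q : BinForm) (z : ℍ) : ℂ :=
  (((Q.negDisc : ℝ) ^ ((1 - (k : ℝ)) / 2) : ℝ) : ℂ) *
    ∑' P : Q.equivClass, calGTerm k Q.negDisc z P

/-! ### The higher Green's function of `SL₂(ℤ)` -/

/-- `z` and `w` lie in the same `SL₂(ℤ)`-orbit. -/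
def OrbitEquiv (z w : ℍ) : Prop := ∃ γ : SL(2, ℤ), γ • w = z

/-- `ω_w`, the order of the stabilizer of `w` in `PSL₂(ℤ) = SL₂(ℤ) / center`. -/
def omega (w : ℍ) : ℕ :=
  Nat.card ((MulAction.stabilizer SL(2, ℤ) w).map
    (QuotientGroup.mk' (Subgroup.center SL(2, ℤ))))

/-- `r_w(z) = |(z - w) / (z - conj w)|`. -/
def rDist (w z : ℍ) : ℝ :=
  ‖((z : ℂ) - w) / ((z : ℂ) - starRingEnd ℂ (w : ℂ))‖

/-- The weight zero hyperbolic Laplacian `- y ^ 2 (∂_x ^ 2 + ∂_y ^ 2)` of `f : ℍ → ℝ`. -/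
def hypLaplacian (f : ℍ → ℝ) (z : ℍ) : ℝ :=
  -z.im ^ 2 * Laplacian.laplacian (fun w : ℂ => f (ofComplex w)) (z : ℂ)

/-- The properties that characterize the higher Green's function `G_k` on `ℍ / SL₂(ℤ)`, a real
function of two points of `ℍ` that are inequivalent under `SL₂(ℤ)`. -/
structure IsHigherGreen (k : ℕ) (G : ℍ → ℍ → ℝ) : Prop where
  /-- `G` is smooth in both variables jointly away from equivalent points. -/
  smooth : ContDiffOn ℝ ∞ (fun p : ℂ × ℂ => G (ofComplex p.1) (ofComplex p.2))
    {p : ℂ × ℂ | 0 < p.1.im ∧ 0 < p.2.im ∧ ¬ OrbitEquiv (ofComplex p.1) (ofComplex p.2)}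
  /-- `G` is invariant under `SL₂(ℤ)` in both variables. -/
  invariant : ∀ (γ₁ γ₂ : SL(2, ℤ)) (z w : ℍ), ¬ OrbitEquiv z w → G (γ₁ • z) (γ₂ • w) = G z w
  /-- `G` is an eigenfunction in the first variable. -/
  laplacian_left : ∀ z w : ℍ, ¬ OrbitEquiv z w →
    hypLaplacian (fun u => G u w) z = k * (1 - k) * G z w
  /-- `G` is an eigenfunction in the second variable. -/
  laplacian_right : ∀ z w : ℍ, ¬ OrbitEquiv z w →
    hypLaplacian (fun u => G z u) w = k * (1 - k) * G z w
  /-- `G(z, w) = 2 ω_w log r_w(z) + O(1)` as `z → w`. -/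
  singularity : ∀ w : ℍ,
    (fun z => G z w - 2 * omega w * Real.log (rDist w z)) =O[𝓝[≠] w] (fun _ => (1 : ℝ))
  /-- `G(z, w) → 0` as `z` approaches the cusp `i ∞`, the only one up to `SL₂(ℤ)`. -/
  cusp : ∀ w : ℍ, Tendsto (fun z => G z w) atImInfty (𝓝 0)

/-! ### Raising operators -/

/-- The Wirtinger derivative `∂F/∂z = (∂_x F - i ∂_y F) / 2`. -/
def dz (F : ℂ → ℂ) (z : ℂ) : ℂ :=
  (fderiv ℝ F z 1 - Complex.I * fderiv ℝ F z Complex.I) / 2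

/-- The raising operator `R_κ = 2 i ∂/∂z + κ / y`. -/
def raise (κ : ℤ) (F : ℂ → ℂ) (z : ℂ) : ℂ :=
  2 * Complex.I * dz F z + κ * (z.im : ℂ)⁻¹ * F z

/-- Repeated raising `R_κ ^ n = R_{κ + 2 n - 2} ∘ ⋯ ∘ R_κ`. -/
def raiseIter (κ : ℤ) : ℕ → (ℂ → ℂ) → ℂ → ℂ
  | 0, F => F
  | n + 1, F => raise (κ + 2 * n) (raiseIter κ n F)

end HigherGreen

end

noncomputable section

namespace HigherGreen

/-! ### Legendre functions of the second kind -/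

/-! Put n = k - 1. The Green's function is the Poincaré series -∑ Q_n(cosh d(γz, w)) over γ in
SL₂(ℤ), where Q_n is the Legendre function of the second kind (`greenSeries`). The identity then
holds term by term.

Existence (`isHigherGreen_greenSeries`). In the coordinates (|z|², x, 1)/y of both points, cosh
d(γz, w) is a linear form with coefficients quadratic in the entries of γ. Every derivative of Q_n
gains one power of decay, which pays for the norm of the form in the chain rule, so all derivatives
of the series converge locally uniformly off the orbit of w (`summableSmoothOn_legendreQ`). The
Legendre equation gives the eigenvalue. The 2ω elements of the stabilizer in SL₂(ℤ), each
contributing log r up to a bounded error, give the singularity, and a majorant uniform in the strip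
|x| ≤ 1/2, y ≥ 1 gives the decay at the cusp.

Uniqueness (`IsHigherGreen.unique`). The maximum principle applies to G - G' + εG': the last summand
forces the value -∞ at w, and then ε tends to 0.

Raising (`raiseIter_legendreQ_quadHeight`). For T = (A|z|² + Bx + C)/y, the function 2i ∂T/∂z is
annihilated by R_2, and its j-th power by R_{2j}, so R_0^n Q_n(T) = Q_n^{(n)}(T) (2i ∂T/∂z)^n. The
conjugate of 2i ∂T/∂z is -P(z,1)/(√D y²) for a form P with T = P_z/√D, and Q_n^{(n)}(t) is a
multiple of ∫_0^{artanh(1/t)} sinh^{2n} (`legendreQ_self`). These are the summands of 𝒢_Q. Finally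
P_z/√D = cosh d(γz, τ_Q) for P = Q ∘ γ, and each P in [Q] comes from 2ω matrices
(`BinForm.tsum_comp`). -/

theorem inv_pow_eq_pow_mul_inv_pow {x : ℝ} (hx : x ≠ 0) (m j : ℕ) :
    x⁻¹ ^ m = x ^ j * x⁻¹ ^ (m + j) := by
  rw [pow_add, mul_left_comm, ← mul_pow, mul_inv_cancel₀ hx, one_pow, mul_one]

/-- The integral `∫_{-1}^1 (1 - s ^ 2) ^ n (t - s) ^ (-p) ds`. -/
def legendreInt (n p : ℕ) (t : ℝ) : ℝ :=
  ∫ s in (-1 : ℝ)..1, (1 - s ^ 2) ^ n * ((t - s)⁻¹) ^ p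

theorem sub_pos_of_mem_uIcc {t s : ℝ} (ht : 1 < t) (hs : s ∈ Set.uIcc (-1 : ℝ) 1) : 0 < t - s := by
  rw [Set.uIcc_of_le (by norm_num)] at hs
  linarith [hs.2]

theorem continuousOn_legendreIntegrand (n p : ℕ) {t : ℝ} (ht : 1 < t) :
    ContinuousOn (fun s : ℝ => (1 - s ^ 2) ^ n * ((t - s)⁻¹) ^ p) (Set.uIcc (-1) 1) := by
  refine ContinuousOn.mul (by fun_prop) (ContinuousOn.pow (ContinuousOn.inv₀ (by fun_prop) ?_) _)
  intro s hs
  exact (sub_pos_of_mem_uIcc ht hs).ne'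

theorem intervalIntegrable_legendreIntegrand (n p : ℕ) {t : ℝ} (ht : 1 < t) :
    IntervalIntegrable (fun s : ℝ => (1 - s ^ 2) ^ n * ((t - s)⁻¹) ^ p) MeasureTheory.volume
      (-1) 1 :=
  (continuousOn_legendreIntegrand n p ht).intervalIntegrable

theorem one_sub_sq_pow_mem {s : ℝ} (hs : s ∈ Set.uIcc (-1 : ℝ) 1) (n : ℕ) :
    0 ≤ (1 - s ^ 2) ^ n ∧ (1 - s ^ 2) ^ n ≤ 1 := by
  rw [Set.uIcc_of_le (by norm_num)] at hs
  have h0 : 0 ≤ 1 - s ^ 2 := by nlinarith [hs.1, hs.2]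
  exact ⟨pow_nonneg h0 n, pow_le_one₀ h0 (by nlinarith [sq_nonneg s])⟩

/-- Differentiation under the integral: to the right of 1 + δ the kernel 1/(t - s) stays below 1/δ,
which gives a constant dominating function. -/
theorem hasDerivAt_legendreInt (n p : ℕ) {t : ℝ} (ht : 1 < t) :
    HasDerivAt (legendreInt n p) (-p * legendreInt n (p + 1) t) t := by
  set δ : ℝ := (t - 1) / 2 with hδ
  have hδ0 : 0 < δ := by rw [hδ]; linarith
  have hS : Set.Ioi (1 + δ) ∈ 𝓝 t := Ioi_mem_nhds (by rw [hδ]; linarith)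
  have key := intervalIntegral.hasDerivAt_integral_of_dominated_loc_of_deriv_le
    (μ := MeasureTheory.volume) (a := -1) (b := 1) (x₀ := t) (s := Set.Ioi (1 + δ))
    (F := fun t s => (1 - s ^ 2) ^ n * ((t - s)⁻¹) ^ p)
    (F' := fun t s => -p * ((1 - s ^ 2) ^ n * ((t - s)⁻¹) ^ (p + 1)))
    (bound := fun _ => p * (δ⁻¹) ^ (p + 1)) hS ?_
    (intervalIntegrable_legendreIntegrand n p ht) ?_ ?_ (by simp) ?_
  · have := key.2
    rw [intervalIntegral.integral_const_mul] at this
    exact this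
  · filter_upwards [hS] with x hx
    have hx : 1 < x := by have : 1 + δ < x := hx; linarith
    exact ((continuousOn_legendreIntegrand n p hx).mono
      Set.uIoc_subset_uIcc).aestronglyMeasurable measurableSet_uIoc
  · exact ((continuousOn_const.mul (continuousOn_legendreIntegrand n (p + 1) ht)).mono
      Set.uIoc_subset_uIcc).aestronglyMeasurable measurableSet_uIoc
  · refine Eventually.of_forall fun s hs x hx => ?_
    have hs' := Set.uIoc_subset_uIcc hs
    have h1 := one_sub_sq_pow_mem hs' n
    have hx : 1 + δ < x := hx
    rw [Set.uIcc_of_le (by norm_num)] at hs'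
    have h2 : δ ≤ x - s := by linarith [hs'.2]
    have h3 : (x - s)⁻¹ ≤ δ⁻¹ := inv_anti₀ hδ0 h2
    have h4 : 0 ≤ (x - s)⁻¹ := inv_nonneg.2 (hδ0.le.trans h2)
    have h5 := pow_le_pow_left₀ h4 h3 (p + 1)
    rw [norm_mul, norm_mul, norm_neg, Real.norm_natCast, Real.norm_of_nonneg h1.1,
      Real.norm_of_nonneg (pow_nonneg h4 _)]
    gcongr
    calc _ ≤ 1 * ((x - s)⁻¹) ^ (p + 1) := by gcongr; exact h1.2
      _ ≤ _ := by rw [one_mul]; exact h5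
  · refine Eventually.of_forall fun s hs x hx => ?_
    have hs' := Set.uIoc_subset_uIcc hs
    have hx : 1 + δ < x := hx
    have hne : x - s ≠ 0 := (sub_pos_of_mem_uIcc (by linarith) hs').ne'
    have h := ((((hasDerivAt_id x).sub_const s).inv hne).pow p).const_mul ((1 - s ^ 2) ^ n)
    refine h.congr_deriv ?_
    rcases p with _ | p
    · simp
    · simp only [id, Nat.add_sub_cancel, Pi.inv_apply, neg_div, one_div, ← inv_pow]
      push_cast
      ring

theorem legendreInt_nonneg (n p : ℕ) {t : ℝ} (ht : 1 < t) : 0 ≤ legendreInt n p t := by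
  refine intervalIntegral.integral_nonneg (by norm_num) fun s hs => ?_
  have hs' : s ∈ Set.uIcc (-1 : ℝ) 1 := by rwa [Set.uIcc_of_le (by norm_num)]
  exact mul_nonneg (one_sub_sq_pow_mem hs' n).1
    (pow_nonneg (inv_nonneg.2 (sub_pos_of_mem_uIcc ht hs').le) _)

theorem legendreInt_le (n p : ℕ) {t : ℝ} (ht : 2 ≤ t) :
    legendreInt n p t ≤ 2 * 2 ^ p * (t⁻¹) ^ p := by
  have ht1 : 1 < t := by linarith
  have : legendreInt n p t ≤ ∫ s in (-1 : ℝ)..1, ((2 * t⁻¹) ^ p : ℝ) := by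
    refine intervalIntegral.integral_mono_on (by norm_num)
      (intervalIntegrable_legendreIntegrand n p ht1) (by simp) fun s hs => ?_
    have hs' : s ∈ Set.uIcc (-1 : ℝ) 1 := by rwa [Set.uIcc_of_le (by norm_num)]
    have h1 := one_sub_sq_pow_mem hs' n
    have h4 : 0 ≤ (t - s)⁻¹ := inv_nonneg.2 (sub_pos_of_mem_uIcc ht1 hs').le
    have h3 : (t - s)⁻¹ ≤ 2 * t⁻¹ := by
      -- For t ≥ 2 and s ≤ 1 one has t - s ≥ t/2.
      have : 2 * t⁻¹ = (t / 2)⁻¹ := by field_simp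
      rw [this]
      exact inv_anti₀ (by linarith) (by linarith [hs.2])
    calc _ ≤ 1 * ((t - s)⁻¹) ^ p := by gcongr; exact h1.2
      _ ≤ _ := by rw [one_mul]; gcongr
  refine this.trans (le_of_eq ?_)
  rw [intervalIntegral.integral_const, smul_eq_mul, mul_pow]
  ring

/-- `∫_{-1}^1 (1 - s ^ 2) ^ n ds = 2 ^ (2 n + 1) n! ^ 2 / (2 n + 1)!`. -/
theorem integral_one_sub_sq_pow (n : ℕ) :
    ((2 * n + 1).factorial : ℝ) * ∫ s in (-1 : ℝ)..1, (1 - s ^ 2) ^ n =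
      2 ^ (2 * n + 1) * (n.factorial : ℝ) ^ 2 := by
  induction n with
  | zero => simp; norm_num
  | succ n ih =>
    have h1 : (∫ s in (-1 : ℝ)..1, ((2 * n + 3) * (1 - s ^ 2) ^ (n + 1) -
        2 * (n + 1) * (1 - s ^ 2) ^ n : ℝ)) = 0 := by
      -- This primitive vanishes at both endpoints and links the integrals for n and n + 1.
      have h : ∀ s ∈ Set.uIcc (-1 : ℝ) 1, HasDerivAt (fun s : ℝ => s * (1 - s ^ 2) ^ (n + 1))
          ((2 * n + 3) * (1 - s ^ 2) ^ (n + 1) - 2 * (n + 1) * (1 - s ^ 2) ^ n) s := by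
        intro s _
        have h := (hasDerivAt_id s).mul ((((hasDerivAt_id s).pow 2).const_sub 1).pow (n + 1))
        refine h.congr_deriv ?_
        simp
        ring
      rw [intervalIntegral.integral_eq_sub_of_hasDerivAt h
        (Continuous.intervalIntegrable (by fun_prop) _ _)]
      simp
    rw [intervalIntegral.integral_sub (Continuous.intervalIntegrable (by fun_prop) _ _)
      (Continuous.intervalIntegrable (by fun_prop) _ _), intervalIntegral.integral_const_mul,
      intervalIntegral.integral_const_mul] at h1
    rw [show 2 * (n + 1) + 1 = 2 * n + 1 + 1 + 1 by ring, Nat.factorial_succ, Nat.factorial_succ,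
      Nat.factorial_succ n]
    push_cast
    linear_combination (2 * (n:ℝ) + 2) * ((2 * n + 1).factorial : ℝ) * h1 + 4 * (n + 1) ^ 2 * ih

/-- The derivatives in `s` of `(1 - s ^ 2) ^ (n + 1) (t - s) ^ (-p)` integrate to zero. -/
theorem legendreInt_by_parts (n p : ℕ) {t : ℝ} (ht : 1 < t) :
    ∫ s in (-1 : ℝ)..1, (-(2 * (n + 1) * s) * ((1 - s ^ 2) ^ n * ((t - s)⁻¹) ^ p) +
      p * ((1 - s ^ 2) ^ (n + 1) * ((t - s)⁻¹) ^ (p + 1))) = 0 := by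
  have h : ∀ s ∈ Set.uIcc (-1 : ℝ) 1,
      HasDerivAt (fun s : ℝ => (1 - s ^ 2) ^ (n + 1) * ((t - s)⁻¹) ^ p)
        (-(2 * (n + 1) * s) * ((1 - s ^ 2) ^ n * ((t - s)⁻¹) ^ p) +
          p * ((1 - s ^ 2) ^ (n + 1) * ((t - s)⁻¹) ^ (p + 1))) s := by
    intro s hs
    have hne : t - s ≠ 0 := (sub_pos_of_mem_uIcc ht hs).ne'
    have h := ((((hasDerivAt_id s).pow 2).const_sub 1).pow (n + 1)).mul
      ((((hasDerivAt_id s).const_sub t).inv hne).pow p)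
    refine h.congr_deriv ?_
    rcases p with _ | p
    · simp; ring
    · simp
      field_simp
      ring
  rw [intervalIntegral.integral_eq_sub_of_hasDerivAt h]
  · simp
  · refine ContinuousOn.intervalIntegrable (ContinuousOn.add ?_ ?_)
    · exact ContinuousOn.mul (by fun_prop) (continuousOn_legendreIntegrand n p ht)
    · exact ContinuousOn.mul (by fun_prop) (continuousOn_legendreIntegrand (n + 1) (p + 1) ht)

/-- The Legendre differential equation. -/
theorem legendreInt_ode (n : ℕ) {t : ℝ} (ht : 1 < t) :
    (t ^ 2 - 1) * ((n + 1) * (n + 2) * legendreInt n (n + 3) t) -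
      2 * t * ((n + 1) * legendreInt n (n + 2) t) - n * (n + 1) * legendreInt n (n + 1) t = 0 := by
  have h := legendreInt_by_parts n (n + 2) ht
  have i1 := (intervalIntegrable_legendreIntegrand n (n + 3) ht).const_mul
    ((t ^ 2 - 1) * ((n + 1) * (n + 2)))
  have i2 := (intervalIntegrable_legendreIntegrand n (n + 2) ht).const_mul (2 * t * (n + 1))
  have i3 := (intervalIntegrable_legendreIntegrand n (n + 1) ht).const_mul ((n : ℝ) * (n + 1))
  -- Over the common factor (t - s)^{-(n+3)}, the Legendre operator turns the kernel into -(n + 1)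
  -- times an exact s-derivative.
  have e : (t ^ 2 - 1) * ((n + 1) * (n + 2) * legendreInt n (n + 3) t) -
      2 * t * ((n + 1) * legendreInt n (n + 2) t) - n * (n + 1) * legendreInt n (n + 1) t =
      -(n + 1) * ∫ s in (-1 : ℝ)..1, (-(2 * (n + 1) * s) * ((1 - s ^ 2) ^ n * ((t - s)⁻¹) ^ (n + 2))
        + (n + 2 : ℕ) * ((1 - s ^ 2) ^ (n + 1) * ((t - s)⁻¹) ^ (n + 2 + 1))) := by
    rw [← intervalIntegral.integral_const_mul]
    unfold legendreInt
    simp only [← mul_assoc (t ^ 2 - 1), ← mul_assoc (2 * t)]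
    rw [← intervalIntegral.integral_const_mul, ← intervalIntegral.integral_const_mul,
      ← intervalIntegral.integral_const_mul, ← intervalIntegral.integral_sub _ i2,
      ← intervalIntegral.integral_sub _ i3]
    · refine intervalIntegral.integral_congr fun s hs => ?_
      have hne : t - s ≠ 0 := (sub_pos_of_mem_uIcc ht hs).ne'
      have e1 : ((t - s)⁻¹) ^ (n + 1) = (t - s) ^ 2 * ((t - s)⁻¹) ^ (n + 3) :=
        inv_pow_eq_pow_mul_inv_pow hne _ _
      have e2 : ((t - s)⁻¹) ^ (n + 2) = (t - s) * ((t - s)⁻¹) ^ (n + 3) := by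
        rw [inv_pow_eq_pow_mul_inv_pow hne (n + 2) 1, pow_one]
      simp only [e1, e2]
      push_cast
      ring
    · simpa only [← mul_assoc] using i1.sub i2
    · simpa only [← mul_assoc] using i1
  rw [e, h, mul_zero]

/-- Integration by parts at exponent 2n + 2 gives t I_{2n+2} = (t² - 1) I_{2n+3}, where I_p is
`legendreInt n p`; this is the cancellation needed. -/
theorem hasDerivAt_sq_sub_one_pow_mul_legendreInt (n : ℕ) {t : ℝ} (ht : 1 < t) :
    HasDerivAt (fun t => (t ^ 2 - 1) ^ (n + 1) * legendreInt n (2 * n + 2) t) 0 t := by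
  have h := legendreInt_by_parts n (2 * n + 2) ht
  have h1 := (((hasDerivAt_id t).pow 2).sub_const 1).pow (n + 1)
  refine (h1.mul (hasDerivAt_legendreInt n (2 * n + 2) ht)).congr_deriv ?_
  have i1 := (intervalIntegrable_legendreIntegrand n (2 * n + 2) ht).const_mul t
  have i2 := (intervalIntegrable_legendreIntegrand n (2 * n + 3) ht).const_mul (t ^ 2 - 1)
  have e : t * legendreInt n (2 * n + 2) t - (t ^ 2 - 1) * legendreInt n (2 * n + 3) t = 0 := by
    have : (2 * n + 2) * (t * legendreInt n (2 * n + 2) t -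
        (t ^ 2 - 1) * legendreInt n (2 * n + 3) t) = 0 := by
      rw [← h]
      unfold legendreInt
      rw [← intervalIntegral.integral_const_mul, ← intervalIntegral.integral_const_mul,
        ← intervalIntegral.integral_sub i1 i2, ← intervalIntegral.integral_const_mul]
      refine intervalIntegral.integral_congr fun s hs => ?_
      have hne : t - s ≠ 0 := (sub_pos_of_mem_uIcc ht hs).ne'
      have e2 : ((t - s)⁻¹) ^ (2 * n + 2) = (t - s) * ((t - s)⁻¹) ^ (2 * n + 3) := by
        rw [inv_pow_eq_pow_mul_inv_pow hne (2 * n + 2) 1, pow_one]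
      simp only [e2]
      push_cast
      ring
    rcases mul_eq_zero.1 this with h | h
    · exact absurd h (by positivity)
    · exact h
  simp only [id, Pi.pow_apply, Nat.add_sub_cancel]
  push_cast
  linear_combination (2 * n + 2) * (t ^ 2 - 1) ^ n * e

/-- Dominated convergence, as t/(t - s) tends to 1 and is at most 2 for t ≥ 2. The limit fixes the
constant in `sq_sub_one_pow_mul_legendreInt`. -/
theorem tendsto_pow_mul_legendreInt (n p : ℕ) :
    Tendsto (fun t => t ^ p * legendreInt n p t) atTop
      (𝓝 (∫ s in (-1 : ℝ)..1, (1 - s ^ 2) ^ n)) := by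
  have e : ∀ᶠ t : ℝ in atTop, (∫ s in (-1 : ℝ)..1, (1 - s ^ 2) ^ n * (t * (t - s)⁻¹) ^ p) =
      t ^ p * legendreInt n p t := by
    filter_upwards with t
    unfold legendreInt
    rw [← intervalIntegral.integral_const_mul]
    congr 1
    ext s
    rw [mul_pow]
    ring
  refine Tendsto.congr' e ?_
  refine intervalIntegral.tendsto_integral_filter_of_dominated_convergence (fun _ => 2 ^ p) ?_ ?_
    (by simp) ?_
  · filter_upwards [eventually_gt_atTop 1] with t ht
    have : ContinuousOn (fun s : ℝ => (1 - s ^ 2) ^ n * (t * (t - s)⁻¹) ^ p)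
        (Set.uIcc (-1) 1) := by
      have := (continuousOn_const (c := t ^ p)).mul (continuousOn_legendreIntegrand n p ht)
      refine this.congr fun s _ => ?_
      simp only [mul_pow, Pi.mul_apply]
      ring
    exact (this.mono Set.uIoc_subset_uIcc).aestronglyMeasurable measurableSet_uIoc
  · filter_upwards [eventually_ge_atTop 2] with t ht
    refine Eventually.of_forall fun s hs => ?_
    have hs' := Set.uIoc_subset_uIcc hs
    have h1 := one_sub_sq_pow_mem hs' n
    have hpos := sub_pos_of_mem_uIcc (t := t) (by linarith) hs'
    rw [Set.uIcc_of_le (by norm_num)] at hs'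
    have h2 : t * (t - s)⁻¹ ≤ 2 := by
      rw [← div_eq_mul_inv, div_le_iff₀ hpos]
      linarith [hs'.2]
    have h3 : 0 ≤ t * (t - s)⁻¹ := mul_nonneg (by linarith) (inv_nonneg.2 hpos.le)
    rw [Real.norm_of_nonneg (mul_nonneg h1.1 (pow_nonneg h3 _))]
    calc _ ≤ 1 * (t * (t - s)⁻¹) ^ p := by gcongr; exact h1.2
      _ ≤ _ := by rw [one_mul]; gcongr
  · refine Eventually.of_forall fun s _ => ?_
    have h1 : Tendsto (fun t : ℝ => t * (t - s)⁻¹) atTop (𝓝 1) := by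
      have h : Tendsto (fun t : ℝ => 1 + s * (t - s)⁻¹) atTop (𝓝 (1 + s * 0)) :=
        tendsto_const_nhds.add (tendsto_const_nhds.mul
          (tendsto_inv_atTop_zero.comp (tendsto_atTop_add_const_right atTop (-s) tendsto_id)))
      rw [mul_zero, add_zero] at h
      refine h.congr' ?_
      filter_upwards [eventually_gt_atTop s] with t ht
      have : t - s ≠ 0 := by linarith [sub_pos.2 ht]
      field_simp
      ring
    simpa using tendsto_const_nhds.mul (h1.pow p)

/-- The left side is constant on (1, ∞), and its value is read off at infinity. -/
theorem sq_sub_one_pow_mul_legendreInt (n : ℕ) {t : ℝ} (ht : 1 < t) :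
    (t ^ 2 - 1) ^ (n + 1) * legendreInt n (2 * n + 2) t = ∫ s in (-1 : ℝ)..1, (1 - s ^ 2) ^ n := by
  have hc : ∀ x ∈ Set.Ioi (1 : ℝ), (fun t => (t ^ 2 - 1) ^ (n + 1) * legendreInt n (2 * n + 2) t) x
      = (t ^ 2 - 1) ^ (n + 1) * legendreInt n (2 * n + 2) t := fun x hx =>
    (convex_Ioi (1 : ℝ)).is_const_of_fderivWithin_eq_zero
      (fun y hy => (hasDerivAt_sq_sub_one_pow_mul_legendreInt n hy).differentiableAt.differentiableWithinAt)
      (fun y hy => by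
        have := (hasDerivAt_sq_sub_one_pow_mul_legendreInt n hy).hasFDerivAt.hasFDerivWithinAt
          (s := Set.Ioi 1)
        rw [this.fderivWithin (isOpen_Ioi.uniqueDiffWithinAt hy)]
        ext
        simp) hx ht
  have h1 : Tendsto (fun t => (t ^ 2 - 1) ^ (n + 1) * legendreInt n (2 * n + 2) t) atTop
      (𝓝 ((1 - 0) ^ (n + 1) * ∫ s in (-1 : ℝ)..1, (1 - s ^ 2) ^ n)) := by
    have h2 : Tendsto (fun t : ℝ => (1 - (t⁻¹) ^ 2) ^ (n + 1)) atTop (𝓝 ((1 - 0) ^ (n + 1))) := by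
      refine (tendsto_const_nhds.sub ?_).pow _
      simpa using (tendsto_inv_atTop_zero (𝕜 := ℝ)).pow 2
    refine (h2.mul (tendsto_pow_mul_legendreInt n (2 * n + 2))).congr' ?_
    filter_upwards [eventually_gt_atTop 0] with t ht
    have : t ^ 2 - 1 = (1 - (t⁻¹) ^ 2) * t ^ 2 := by field_simp
    rw [this, mul_pow, ← pow_mul]
    ring
  have h3 := h1.congr' (f₂ := fun _ => (t ^ 2 - 1) ^ (n + 1) * legendreInt n (2 * n + 2) t) (by
    filter_upwards [eventually_gt_atTop 1] with x hx
    exact hc x hx)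
  have := tendsto_nhds_unique h3 tendsto_const_nhds
  rw [← this]
  ring

/-! ### The hyperbolic sine integral as a Legendre integral -/

/-- `∫_0^{artanh (1 / t)} sinh ^ (2 n) θ dθ`. -/
def sinhInt (n : ℕ) (t : ℝ) : ℝ := ∫ θ in (0 : ℝ)..Real.artanh t⁻¹, Real.sinh θ ^ (2 * n)

theorem artanh_eventuallyEq {x : ℝ} (hx : x ∈ Set.Ioo (-1 : ℝ) 1) :
    Real.artanh =ᶠ[𝓝 x] fun x => 1 / 2 * Real.log ((1 + x) / (1 - x)) := by
  filter_upwards [Ioo_mem_nhds hx.1 hx.2] with y hy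
  exact Real.artanh_eq_half_log (Set.Ioo_subset_Icc_self hy)

theorem hasDerivAt_artanh {x : ℝ} (hx : x ∈ Set.Ioo (-1 : ℝ) 1) :
    HasDerivAt Real.artanh ((1 - x ^ 2)⁻¹) x := by
  have h1 : 0 < 1 + x := by linarith [hx.1]
  have h2 : 0 < 1 - x := by linarith [hx.2]
  have h := (((((hasDerivAt_id x).const_add 1).div ((hasDerivAt_id x).const_sub 1) h2.ne').log
    (div_pos h1 h2).ne').const_mul (1 / 2)).congr_of_eventuallyEq (artanh_eventuallyEq hx)
  refine h.congr_deriv ?_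
  have : 1 - x ^ 2 = (1 + x) * (1 - x) := by ring
  rw [this]
  simp only [id, Pi.div_apply]
  field_simp
  ring

/-- At θ = artanh(1/t) one has sinh² θ = 1/(t² - 1), and dθ/dt = -1/(t² - 1). -/
theorem hasDerivAt_sinhInt (n : ℕ) {t : ℝ} (ht : 1 < t) :
    HasDerivAt (sinhInt n) (-((t ^ 2 - 1) ^ (n + 1))⁻¹) t := by
  have ht0 : 0 < t := by linarith
  have hx : t⁻¹ ∈ Set.Ioo (-1 : ℝ) 1 := ⟨by linarith [inv_pos.2 ht0], inv_lt_one_of_one_lt₀ ht⟩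
  have h1 : HasDerivAt (fun u => ∫ θ in (0 : ℝ)..u, Real.sinh θ ^ (2 * n))
      (Real.sinh (Real.artanh t⁻¹) ^ (2 * n)) (Real.artanh t⁻¹) :=
    intervalIntegral.integral_hasDerivAt_right
      (Continuous.intervalIntegrable (by fun_prop) _ _)
      (Continuous.stronglyMeasurableAtFilter (by fun_prop) _ _) (by fun_prop)
  have h2 := h1.comp t ((hasDerivAt_artanh hx).comp t (hasDerivAt_inv ht0.ne'))
  refine h2.congr_deriv ?_
  have h3 : 0 < t ^ 2 - 1 := by nlinarith
  have h4 : Real.sinh (Real.artanh t⁻¹) ^ 2 = (t ^ 2 - 1)⁻¹ := by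
    rw [Real.sinh_artanh hx, div_pow, Real.sq_sqrt]
    · have : 1 - t⁻¹ ^ 2 = (t ^ 2 - 1) / t ^ 2 := by field_simp
      rw [this]
      field_simp
    · have := hx.2
      have := inv_pos.2 ht0
      nlinarith
  rw [pow_mul, h4]
  have : 1 - t⁻¹ ^ 2 = (t ^ 2 - 1) / t ^ 2 := by field_simp
  rw [this]
  rw [inv_div, pow_succ, mul_inv, inv_pow]
  field_simp
  ring

theorem tendsto_sinhInt (n : ℕ) : Tendsto (sinhInt n) atTop (𝓝 0) := by
  have h1 : Continuous (fun u => ∫ θ in (0 : ℝ)..u, Real.sinh θ ^ (2 * n)) :=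
    intervalIntegral.continuous_primitive
      (fun _ _ => Continuous.intervalIntegrable (by fun_prop) _ _) _
  have h2 : Tendsto (fun t : ℝ => Real.artanh t⁻¹) atTop (𝓝 (Real.artanh 0)) :=
    (hasDerivAt_artanh (x := 0) (by simp)).continuousAt.tendsto.comp tendsto_inv_atTop_zero
  rw [Real.artanh_zero] at h2
  have := (h1.tendsto 0).comp h2
  simp only [Function.comp_def, intervalIntegral.integral_same] at this
  exact this

theorem tendsto_legendreInt (n p : ℕ) : Tendsto (legendreInt n (p + 1)) atTop (𝓝 0) := by
  have h : Tendsto (fun t : ℝ => 2 * 2 ^ (p + 1) * (t⁻¹) ^ (p + 1)) atTop (𝓝 0) := by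
    simpa using (tendsto_inv_atTop_zero (𝕜 := ℝ)).pow (p + 1) |>.const_mul (2 * 2 ^ (p + 1) : ℝ)
  refine squeeze_zero' ?_ ?_ h
  · filter_upwards [eventually_gt_atTop 1] with t ht using legendreInt_nonneg n _ ht
  · filter_upwards [eventually_ge_atTop 2] with t ht using legendreInt_le n _ ht

/-- Both sides vanish at infinity and both derivatives are the same multiple of (t² - 1)^{-(n+1)},
by `sq_sub_one_pow_mul_legendreInt` and `hasDerivAt_sinhInt`. -/
theorem legendreInt_two_mul_add_one (n : ℕ) {t : ℝ} (ht : 1 < t) :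
    legendreInt n (2 * n + 1) t =
      (2 * n + 1) * (∫ s in (-1 : ℝ)..1, (1 - s ^ 2) ^ n) * sinhInt n t := by
  set B := ∫ s in (-1 : ℝ)..1, (1 - s ^ 2) ^ n with hB
  have hd : ∀ x ∈ Set.Ioi (1 : ℝ),
      HasDerivAt (fun t => legendreInt n (2 * n + 1) t - (2 * n + 1) * B * sinhInt n t) 0 x := by
    intro x hx
    have hx : 1 < x := hx
    refine ((hasDerivAt_legendreInt n (2 * n + 1) hx).sub
      ((hasDerivAt_sinhInt n hx).const_mul ((2 * n + 1) * B))).congr_deriv ?_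
    have h3 : 0 < x ^ 2 - 1 := by nlinarith
    rw [hB, ← sq_sub_one_pow_mul_legendreInt n hx]
    field_simp
    push_cast
    ring
  have hc : ∀ x ∈ Set.Ioi (1 : ℝ),
      (fun t => legendreInt n (2 * n + 1) t - (2 * n + 1) * B * sinhInt n t) x =
      legendreInt n (2 * n + 1) t - (2 * n + 1) * B * sinhInt n t := fun x hx =>
    (convex_Ioi (1 : ℝ)).is_const_of_fderivWithin_eq_zero
      (fun y hy => (hd y hy).differentiableAt.differentiableWithinAt)
      (fun y hy => by
        rw [((hd y hy).hasFDerivAt.hasFDerivWithinAt (s := Set.Ioi 1)).fderivWithin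
          (isOpen_Ioi.uniqueDiffWithinAt hy)]
        ext
        simp) hx ht
  have h1 := (tendsto_legendreInt n (2 * n)).sub
    ((tendsto_sinhInt n).const_mul ((2 * n + 1) * B))
  have h3 := h1.congr'
    (f₂ := fun _ => legendreInt n (2 * n + 1) t - (2 * n + 1) * B * sinhInt n t) (by
    filter_upwards [eventually_gt_atTop 1] with x hx
    exact hc x hx)
  have := tendsto_nhds_unique h3 tendsto_const_nhds
  linarith

/-! ### Legendre functions: differential equation, decay, singularity at 1 -/

/-- The Legendre function of the second kind and its derivatives:
`legendreQ n j` is the `j`-th derivative of `Q_n` on `(1, ∞)`. -/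
def legendreQ (n j : ℕ) (t : ℝ) : ℝ :=
  (-1) ^ j * (n + 1).ascFactorial j / 2 ^ (n + 1) * legendreInt n (n + 1 + j) t

theorem hasDerivAt_legendreQ (n j : ℕ) {t : ℝ} (ht : 1 < t) :
    HasDerivAt (legendreQ n j) (legendreQ n (j + 1) t) t := by
  refine ((hasDerivAt_legendreInt n (n + 1 + j) ht).const_mul _).congr_deriv ?_
  rw [legendreQ, Nat.ascFactorial_succ, ← add_assoc]
  push_cast
  ring

theorem legendreQ_ode (n : ℕ) {t : ℝ} (ht : 1 < t) :
    (t ^ 2 - 1) * legendreQ n 2 t + 2 * t * legendreQ n 1 t = n * (n + 1) * legendreQ n 0 t := by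
  have := legendreInt_ode n ht
  simp only [legendreQ, Nat.ascFactorial_succ, Nat.ascFactorial_zero]
  push_cast
  simp only [add_zero, add_assoc] at this ⊢
  norm_num at this ⊢
  linear_combination 1 / 2 ^ (n + 1) * this

/-- The extra j powers of decay are essential: they absorb the factor ‖ℓ‖^j that appears when Q_n ∘
ℓ is differentiated j times. -/
theorem abs_legendreQ_le (n j : ℕ) :
    ∃ C, 0 ≤ C ∧ ∀ t : ℝ, 2 ≤ t → |legendreQ n j t| ≤ C * (t⁻¹) ^ (n + 1 + j) := by
  refine ⟨(n + 1).ascFactorial j / 2 ^ (n + 1) * (2 * 2 ^ (n + 1 + j)), by positivity,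
    fun t ht => ?_⟩
  have h1 := legendreInt_le n (n + 1 + j) ht
  have h0 := legendreInt_nonneg n (n + 1 + j) (t := t) (by linarith)
  rw [legendreQ, abs_mul, abs_div, abs_mul, abs_pow, abs_neg, abs_one, one_pow, one_mul,
    Nat.abs_cast, abs_of_pos (by positivity : (0 : ℝ) < 2 ^ (n + 1)), abs_of_nonneg h0]
  calc _ ≤ (n + 1).ascFactorial j / 2 ^ (n + 1) * (2 * 2 ^ (n + 1 + j) * (t⁻¹) ^ (n + 1 + j)) := by
        gcongr
    _ = _ := by ring

/-- The n-th derivative has kernel exponent 2n + 1, exactly the case in which the Legendre integral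
is a sinh integral. The constant comes from the value of ∫(1 - s²)^n. -/
theorem legendreQ_self (n : ℕ) {t : ℝ} (ht : 1 < t) :
    legendreQ n n t = (-1) ^ n * 2 ^ n * n.factorial * sinhInt n t := by
  have h1 := integral_one_sub_sq_pow n
  have h2 := legendreInt_two_mul_add_one n ht
  rw [legendreQ, show n + 1 + n = 2 * n + 1 by ring, h2]
  have h3 : (n.factorial : ℝ) * ((n + 1).ascFactorial n : ℝ) * (2 * n + 1) =
      (2 * n + 1).factorial := by
    have := Nat.factorial_mul_ascFactorial n n
    rw [Nat.factorial_succ, show 2 * n = n + n by ring, ← this]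
    push_cast
    ring
  have hn : (n.factorial : ℝ) ≠ 0 := by positivity
  rw [← h3] at h1
  have e : (2 : ℝ) ^ (n + 1) * 2 ^ n = 2 ^ (2 * n + 1) := by ring
  have h4 : ((n + 1).ascFactorial n : ℝ) * ((2 * n + 1) *
      ∫ s in (-1 : ℝ)..1, (1 - s ^ 2) ^ n) = 2 ^ (n + 1) * 2 ^ n * n.factorial := by
    apply mul_left_cancel₀ hn
    rw [e]
    linear_combination h1
  calc _ = (-1) ^ n / 2 ^ (n + 1) * (((n + 1).ascFactorial n : ℝ) * ((2 * n + 1) *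
      ∫ s in (-1 : ℝ)..1, (1 - s ^ 2) ^ n)) * sinhInt n t := by ring
    _ = _ := by
      rw [h4]
      field_simp

theorem legendreQ_zero_zero {t : ℝ} (ht : 1 < t) :
    legendreQ 0 0 t = 1 / 2 * Real.log ((t + 1) / (t - 1)) := by
  have h : ∀ s ∈ Set.uIcc (-1 : ℝ) 1, HasDerivAt (fun s : ℝ => -Real.log (t - s))
      ((1 - s ^ 2) ^ 0 * ((t - s)⁻¹) ^ 1) s := by
    intro s hs
    have hne : t - s ≠ 0 := (sub_pos_of_mem_uIcc ht hs).ne'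
    refine (((hasDerivAt_id s).const_sub t).log hne).neg.congr_deriv ?_
    simp [div_eq_mul_inv]
  simp only [legendreQ, legendreInt]
  rw [intervalIntegral.integral_eq_sub_of_hasDerivAt h
    (intervalIntegrable_legendreIntegrand 0 1 ht), Real.log_div (by linarith) (by linarith)]
  simp
  ring

/-- Integration by parts turns the difference into an integral with an additional factor 1 - s.
Since (1 - s)/(t - s) ≤ 1, that factor removes the singularity at t = 1. -/
theorem abs_legendreQ_succ_sub_le (n : ℕ) {t : ℝ} (ht : 1 < t) :
    |legendreQ (n + 1) 0 t - legendreQ n 0 t| ≤ 1 := by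
  have h := legendreInt_by_parts n (n + 1) ht
  have i0 := (intervalIntegrable_legendreIntegrand n (n + 1) ht)
  have i1 : IntervalIntegrable
      (fun s : ℝ => -(2 * (n + 1) * s) * ((1 - s ^ 2) ^ n * ((t - s)⁻¹) ^ (n + 1)))
      MeasureTheory.volume (-1) 1 :=
    ((by fun_prop : ContinuousOn (fun s : ℝ => -(2 * (n + 1) * s)) (Set.uIcc (-1) 1)).mul
      (continuousOn_legendreIntegrand n (n + 1) ht)).intervalIntegrable
  have i2 := (intervalIntegrable_legendreIntegrand (n + 1) (n + 1 + 1) ht).const_mul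
    ((n + 1 : ℕ) : ℝ)
  have i3 : IntervalIntegrable
      (fun s : ℝ => (1 - s) * ((1 - s ^ 2) ^ n * ((t - s)⁻¹) ^ (n + 1)))
      MeasureTheory.volume (-1) 1 :=
    ((by fun_prop : ContinuousOn (fun s : ℝ => 1 - s) (Set.uIcc (-1) 1)).mul
      (continuousOn_legendreIntegrand n (n + 1) ht)).intervalIntegrable
  rw [intervalIntegral.integral_add i1 i2, intervalIntegral.integral_const_mul] at h
  set K := ∫ s in (-1 : ℝ)..1, (1 - s) * ((1 - s ^ 2) ^ n * ((t - s)⁻¹) ^ (n + 1)) with hK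
  have h1 : (∫ s in (-1 : ℝ)..1, -(2 * (n + 1) * s) * ((1 - s ^ 2) ^ n * ((t - s)⁻¹) ^ (n + 1))) =
      2 * (n + 1) * (K - legendreInt n (n + 1) t) := by
    rw [hK, legendreInt, ← intervalIntegral.integral_sub i3 i0,
      ← intervalIntegral.integral_const_mul]
    congr 1
    ext s
    ring
  rw [h1] at h
  have h2 : legendreQ (n + 1) 0 t - legendreQ n 0 t = -(1 / 2 ^ (n + 1) * K) := by
    have h3 : legendreInt (n + 1) (n + 1 + 1) t = -2 * (K - legendreInt n (n + 1) t) := by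
      have hn : ((n : ℝ) + 1) ≠ 0 := by positivity
      apply mul_left_cancel₀ hn
      unfold legendreInt at h ⊢
      push_cast at h
      linear_combination h
    simp only [legendreQ, add_zero, Nat.ascFactorial_zero, h3]
    rw [pow_succ 2 (n + 1)]
    field_simp
    ring
  have hb : ∀ s ∈ Set.Icc (-1 : ℝ) 1,
      0 ≤ (1 - s) * ((1 - s ^ 2) ^ n * ((t - s)⁻¹) ^ (n + 1)) ∧
      (1 - s) * ((1 - s ^ 2) ^ n * ((t - s)⁻¹) ^ (n + 1)) ≤ 2 ^ n := by
    intro s hs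
    have hp : 0 < t - s := by linarith [hs.2]
    have e : (1 - s) * ((1 - s ^ 2) ^ n * ((t - s)⁻¹) ^ (n + 1)) =
        ((1 - s) * (t - s)⁻¹) ^ (n + 1) * (1 + s) ^ n := by
      rw [show 1 - s ^ 2 = (1 - s) * (1 + s) by ring, mul_pow, mul_pow]
      ring
    have h5 : (1 - s) * (t - s)⁻¹ ≤ 1 := by
      rw [← div_eq_mul_inv, div_le_one hp]; linarith
    have h6 : 0 ≤ (1 - s) * (t - s)⁻¹ := mul_nonneg (by linarith [hs.2]) (inv_nonneg.2 hp.le)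
    have h7 : 0 ≤ 1 + s := by linarith [hs.1]
    rw [e]
    refine ⟨by positivity, ?_⟩
    calc _ ≤ 1 * (2 : ℝ) ^ n := by
          gcongr
          · exact pow_le_one₀ h6 h5
          · linarith [hs.2]
      _ = _ := one_mul _
  have hK0 : 0 ≤ K := intervalIntegral.integral_nonneg (by norm_num) fun s hs => (hb s hs).1
  have hK1 : K ≤ 2 ^ (n + 1) := by
    have := intervalIntegral.integral_mono_on (a := (-1 : ℝ)) (b := 1) (by norm_num) i3
      (intervalIntegrable_const (c := (2 : ℝ) ^ n)) fun s hs => (hb s hs).2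
    rw [intervalIntegral.integral_const, smul_eq_mul] at this
    refine this.trans (le_of_eq ?_)
    ring
  rw [h2, abs_neg, abs_of_nonneg (by positivity)]
  rw [one_div, inv_mul_le_iff₀ (by positivity), mul_one]
  exact hK1

/-- Telescoping down to Q_0, which is the logarithm itself: every Q_n has the same singularity at 1
up to a bounded term. -/
theorem abs_legendreQ_sub_log_le (n : ℕ) {t : ℝ} (ht : 1 < t) :
    |legendreQ n 0 t - 1 / 2 * Real.log ((t + 1) / (t - 1))| ≤ n := by
  induction n with
  | zero => simp [legendreQ_zero_zero ht]
  | succ n ih =>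
    have := abs_legendreQ_succ_sub_le n ht
    push_cast
    calc _ = |(legendreQ (n + 1) 0 t - legendreQ n 0 t) +
          (legendreQ n 0 t - 1 / 2 * Real.log ((t + 1) / (t - 1)))| := by ring_nf
      _ ≤ _ := (abs_add_le _ _).trans (by linarith)

/-! ### Series of smooth functions -/

section Series

variable {ι X Y E F : Type} [NormedAddCommGroup X] [NormedSpace ℝ X] [NormedAddCommGroup Y]
  [NormedSpace ℝ Y] [NormedAddCommGroup E] [NormedSpace ℝ E] [NormedAddCommGroup F]
  [NormedSpace ℝ F]

/-- A family of functions that are smooth on `U`, all of whose derivatives are locally uniformly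
summable in norm. -/
structure SummableSmoothOn (f : ι → X → E) (U : Set X) : Prop where
  contDiffOn : ∀ i, ContDiffOn ℝ ∞ (f i) U
  bound : ∀ x ∈ U, ∀ n : ℕ, ∃ u : ι → ℝ, Summable u ∧
    ∀ᶠ y in 𝓝 x, ∀ i, ‖iteratedFDeriv ℝ n (f i) y‖ ≤ u i

theorem eventually_norm_iteratedFDeriv_le {g : X → E} {U : Set X} (hU : IsOpen U)
    (hg : ContDiffOn ℝ ∞ g U) {x : X} (hx : x ∈ U) (n : ℕ) :
    ∀ᶠ y in 𝓝 x, ‖iteratedFDeriv ℝ n g y‖ ≤ ‖iteratedFDeriv ℝ n g x‖ + 1 := by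
  have h : ContinuousAt (iteratedFDeriv ℝ n g) x :=
    ((hg.contDiffAt (hU.mem_nhds hx)).iteratedFDeriv_right (m := 0) (i := n)
      (by exact_mod_cast le_top)).continuousAt
  exact (h.norm.eventually_lt_const (lt_add_one _)).mono fun y hy => hy.le

theorem exists_norm_iteratedFDeriv_le {g : X → E} {U : Set X} (hU : IsOpen U)
    (hg : ContDiffOn ℝ ∞ g U) {x : X} (hx : x ∈ U) (n : ℕ) :
    ∃ M, 1 ≤ M ∧ ∀ᶠ y in 𝓝 x, ∀ j ≤ n, ‖iteratedFDeriv ℝ j g y‖ ≤ M := by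
  -- The leading 1 secures M ≥ 1, so that M ≤ M^j for j ≥ 1 in the bound for compositions.
  refine ⟨1 + ∑ j ∈ Finset.range (n + 1), (‖iteratedFDeriv ℝ j g x‖ + 1), ?_, ?_⟩
  · linarith [Finset.sum_nonneg (s := Finset.range (n + 1))
      (f := fun j => ‖iteratedFDeriv ℝ j g x‖ + 1) fun j _ => by positivity]
  · have h := (eventually_all_finset (Finset.range (n + 1))).2
      fun j _ => eventually_norm_iteratedFDeriv_le hU hg hx j
    filter_upwards [h] with y hy j hj
    have hj' : j ∈ Finset.range (n + 1) := Finset.mem_range.2 (by omega)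
    refine (hy j hj').trans ?_
    have := Finset.single_le_sum (f := fun j => ‖iteratedFDeriv ℝ j g x‖ + 1)
      (fun j _ => by positivity) hj'
    linarith

namespace SummableSmoothOn

variable {f : ι → X → E} {U : Set X}

theorem bound_le (h : SummableSmoothOn f U) {x : X} (hx : x ∈ U) (n : ℕ) :
    ∃ u : ι → ℝ, Summable u ∧
      ∀ᶠ y in 𝓝 x, ∀ i, ∀ j ≤ n, ‖iteratedFDeriv ℝ j (f i) y‖ ≤ u i := by
  choose u hu hb using h.bound x hx
  refine ⟨fun i => ∑ j ∈ Finset.range (n + 1), u j i, summable_sum fun j _ => hu j, ?_⟩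
  have h' := (eventually_all_finset (Finset.range (n + 1))).2 fun j _ => hb j
  filter_upwards [h'] with y hy i j hj
  have hj' : j ∈ Finset.range (n + 1) := Finset.mem_range.2 (by omega)
  exact (hy j hj' i).trans (Finset.single_le_sum (f := fun j => u j i)
    (fun j hj => (norm_nonneg _).trans (hy j hj i)) hj')

theorem summable [CompleteSpace E] (h : SummableSmoothOn f U) {x : X} (hx : x ∈ U) :
    Summable fun i => f i x := by
  obtain ⟨u, hu, hb⟩ := h.bound x hx 0
  exact hu.of_norm_bounded fun i => by simpa using hb.self_of_nhds i

theorem fderiv (hU : IsOpen U) (h : SummableSmoothOn f U) :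
    SummableSmoothOn (fun i => fderiv ℝ (f i)) U where
  contDiffOn i := (h.contDiffOn i).fderiv_of_isOpen hU (by norm_num)
  bound x hx n := by
    obtain ⟨u, hu, hb⟩ := h.bound x hx (n + 1)
    refine ⟨u, hu, hb.mono fun y hy i => ?_⟩
    rw [norm_iteratedFDeriv_fderiv]
    exact hy i

theorem differentiableAt (hU : IsOpen U) (h : SummableSmoothOn f U) {x : X} (hx : x ∈ U) (i : ι) :
    DifferentiableAt ℝ (f i) x :=
  ((h.contDiffOn i).contDiffAt (hU.mem_nhds hx)).differentiableAt (by norm_num)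

theorem hasFDerivAt_tsum [CompleteSpace E] (hU : IsOpen U) (h : SummableSmoothOn f U) {x : X}
    (hx : x ∈ U) :
    HasFDerivAt (fun y => ∑' i, f i y) (∑' i, _root_.fderiv ℝ (f i) x) x := by
  obtain ⟨u, hu, hb⟩ := h.bound x hx 1
  obtain ⟨ε, hε, hball⟩ := Metric.eventually_nhds_iff_ball.1 (hb.and (hU.mem_nhds hx))
  refine hasFDerivAt_tsum_of_isPreconnected hu Metric.isOpen_ball
    (convex_ball x ε).isPreconnected (fun i y hy => ?_) (fun i y hy => ?_)
    (Metric.mem_ball_self hε) (h.summable hx) (Metric.mem_ball_self hε)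
  · exact (h.differentiableAt hU (hball y hy).2 i).hasFDerivAt
  · have := (hball y hy).1 i
    rwa [show (1 : ℕ) = 0 + 1 from rfl, ← norm_iteratedFDeriv_fderiv,
      norm_iteratedFDeriv_zero] at this

/-- The target space is quantified inside the induction, because the derivative of the series takes
values in a space of linear maps. -/
theorem contDiffOn_tsum_nat {ι X : Type} [NormedAddCommGroup X] [NormedSpace ℝ X] {U : Set X}
    (hU : IsOpen U) (n : ℕ) : ∀ {E : Type} [NormedAddCommGroup E] [NormedSpace ℝ E]
    [CompleteSpace E] {f : ι → X → E}, SummableSmoothOn f U →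
      ContDiffOn ℝ n (fun y => ∑' i, f i y) U := by
  induction n with
  | zero =>
    intro E _ _ _ f h
    exact contDiffOn_zero.2 fun x hx => (h.hasFDerivAt_tsum hU hx).continuousAt.continuousWithinAt
  | succ n ih =>
    intro E _ _ _ f h
    rw [Nat.cast_succ, contDiffOn_succ_iff_fderiv_of_isOpen hU]
    refine ⟨fun x hx => (h.hasFDerivAt_tsum hU hx).differentiableAt.differentiableWithinAt,
      by simp, ?_⟩
    exact (ih (h.fderiv hU)).congr fun x hx => (h.hasFDerivAt_tsum hU hx).fderiv

theorem contDiffOn_tsum [CompleteSpace E] (hU : IsOpen U) (h : SummableSmoothOn f U) :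
    ContDiffOn ℝ ∞ (fun y => ∑' i, f i y) U :=
  contDiffOn_infty.2 fun n => contDiffOn_tsum_nat hU n h

theorem clm_comp (hU : IsOpen U) (h : SummableSmoothOn f U) (L : E →L[ℝ] F) :
    SummableSmoothOn (fun i x => L (f i x)) U where
  contDiffOn i := L.contDiff.comp_contDiffOn (h.contDiffOn i)
  bound x hx n := by
    obtain ⟨u, hu, hb⟩ := h.bound x hx n
    refine ⟨fun i => ‖L‖ * u i, hu.mul_left _, ?_⟩
    filter_upwards [hb, hU.mem_nhds hx] with y hy hyU i
    refine (L.norm_iteratedFDeriv_comp_left ((h.contDiffOn i).contDiffAt (hU.mem_nhds hyU))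
      (by exact_mod_cast le_top)).trans ?_
    gcongr
    exact hy i

theorem add {g : ι → X → E} (hU : IsOpen U) (h : SummableSmoothOn f U)
    (h' : SummableSmoothOn g U) : SummableSmoothOn (fun i x => f i x + g i x) U where
  contDiffOn i := (h.contDiffOn i).add (h'.contDiffOn i)
  bound x hx n := by
    obtain ⟨u, hu, hb⟩ := h.bound x hx n
    obtain ⟨u', hu', hb'⟩ := h'.bound x hx n
    refine ⟨fun i => u i + u' i, hu.add hu', ?_⟩
    filter_upwards [hb, hb', hU.mem_nhds hx] with y hy hy' hyU i
    have e : iteratedFDeriv ℝ n (fun x => f i x + g i x) y =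
        iteratedFDeriv ℝ n (f i) y + iteratedFDeriv ℝ n (g i) y :=
      iteratedFDeriv_add_apply
        (((h.contDiffOn i).contDiffAt (hU.mem_nhds hyU)).of_le (by exact_mod_cast le_top))
        (((h'.contDiffOn i).contDiffAt (hU.mem_nhds hyU)).of_le (by exact_mod_cast le_top))
    rw [e]
    exact (norm_add_le _ _).trans (add_le_add (hy i) (hy' i))

theorem const_mul {A : Type} [NormedRing A] [NormedAlgebra ℝ A] {f : ι → X → A} (hU : IsOpen U)
    (h : SummableSmoothOn f U) {g : X → A} (hg : ContDiffOn ℝ ∞ g U) :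
    SummableSmoothOn (fun i x => g x * f i x) U where
  contDiffOn i := hg.mul (h.contDiffOn i)
  bound x hx n := by
    obtain ⟨u, hu, hb⟩ := h.bound_le hx n
    obtain ⟨M, hM, hb'⟩ := exists_norm_iteratedFDeriv_le hU hg hx n
    refine ⟨fun i => ∑ j ∈ Finset.range (n + 1), (n.choose j : ℝ) * M * u i,
      summable_sum fun j _ => hu.mul_left _, ?_⟩
    filter_upwards [hb, hb', hU.mem_nhds hx] with y hy hy' hyU i
    rw [← iteratedFDerivWithin_of_isOpen n hU hyU]
    refine (norm_iteratedFDerivWithin_mul_le hg (h.contDiffOn i) hU.uniqueDiffOn hyU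
      (by exact_mod_cast le_top)).trans (Finset.sum_le_sum fun j hj => ?_)
    rw [iteratedFDerivWithin_of_isOpen _ hU hyU, iteratedFDerivWithin_of_isOpen _ hU hyU]
    have hj := Finset.mem_range.1 hj
    gcongr
    · exact hy' j (by omega)
    · exact hy i (n - j) (by omega)

theorem comp {V : Set Y} {f : ι → Y → E} {c : X → Y} (hU : IsOpen U) (hV : IsOpen V)
    (h : SummableSmoothOn f V) (hc : ContDiffOn ℝ ∞ c U) (hm : Set.MapsTo c U V) :
    SummableSmoothOn (fun i x => f i (c x)) U where
  contDiffOn i := (h.contDiffOn i).comp hc hm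
  bound x hx n := by
    obtain ⟨u, hu, hb⟩ := h.bound_le (hm hx) n
    obtain ⟨M, hM, hb'⟩ := exists_norm_iteratedFDeriv_le hU hc hx n
    refine ⟨fun i => n.factorial * u i * M ^ n, (hu.mul_left _).mul_right _, ?_⟩
    have hcx : ContinuousAt c x := (hc.contDiffAt (hU.mem_nhds hx)).continuousAt
    filter_upwards [hcx.eventually hb, hb', hU.mem_nhds hx] with y hy hy' hyU i
    rw [← iteratedFDerivWithin_of_isOpen n hU hyU]
    refine norm_iteratedFDerivWithin_comp_le (h.contDiffOn i) hc (by exact_mod_cast le_top)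
      hV.uniqueDiffOn hU.uniqueDiffOn hm hyU (fun j hj => ?_) (fun j hj1 hj => ?_)
    · rw [iteratedFDerivWithin_of_isOpen _ hV (hm hyU)]
      exact hy i j hj
    · rw [iteratedFDerivWithin_of_isOpen _ hU hyU]
      exact (hy' j hj).trans (le_self_pow₀ hM (by omega))

end SummableSmoothOn

/-! ### Series of Legendre functions of linear forms -/

theorem iteratedDerivWithin_legendreQ (n j : ℕ) {t : ℝ} (ht : 1 < t) :
    iteratedDerivWithin j (legendreQ n 0) (Set.Ioi 1) t = legendreQ n j t := by
  induction j generalizing t with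
  | zero => simp
  | succ j ih =>
    rw [iteratedDerivWithin_succ]
    have h : HasDerivWithinAt (iteratedDerivWithin j (legendreQ n 0) (Set.Ioi 1))
        (legendreQ n (j + 1) t) (Set.Ioi 1) t :=
      (hasDerivAt_legendreQ n j ht).hasDerivWithinAt.congr (fun y hy => ih hy) (ih ht)
    exact h.derivWithin (isOpen_Ioi.uniqueDiffWithinAt ht)

theorem contDiffOn_legendreQ (n j : ℕ) : ContDiffOn ℝ ∞ (legendreQ n j) (Set.Ioi 1) := by
  refine contDiffOn_infty.2 fun m => ?_
  induction m generalizing j with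
  | zero =>
    exact contDiffOn_zero.2 fun t ht =>
      (hasDerivAt_legendreQ n j ht).continuousAt.continuousWithinAt
  | succ m ih =>
    rw [Nat.cast_succ, contDiffOn_succ_iff_deriv_of_isOpen isOpen_Ioi]
    refine ⟨fun t ht => (hasDerivAt_legendreQ n j ht).differentiableAt.differentiableWithinAt,
      by simp, ?_⟩
    exact (ih (j + 1)).congr fun t ht => (hasDerivAt_legendreQ n j ht).deriv

/-- As ℓ is linear, the chain rule has a single term: the j-th derivative is Q_n^{(j)}(ℓ x) times
the j-fold tensor power of ℓ. -/
theorem norm_iteratedFDeriv_legendreQ_comp_le (n j : ℕ) (ℓ : X →L[ℝ] ℝ) {x : X}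
    (hx : 1 < ℓ x) :
    ‖iteratedFDeriv ℝ j (fun y => legendreQ n 0 (ℓ y)) x‖ ≤ |legendreQ n j (ℓ x)| * ‖ℓ‖ ^ j := by
  have ho : IsOpen (ℓ ⁻¹' Set.Ioi 1) := isOpen_Ioi.preimage ℓ.continuous
  have h := ℓ.iteratedFDerivWithin_comp_right (contDiffOn_legendreQ n 0)
    isOpen_Ioi.uniqueDiffOn ho.uniqueDiffOn (x := x) hx (i := j) (by exact_mod_cast le_top)
  rw [iteratedFDerivWithin_of_isOpen j ho hx] at h
  change ‖iteratedFDeriv ℝ j (legendreQ n 0 ∘ ℓ) x‖ ≤ _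
  rw [h]
  refine (ContinuousMultilinearMap.norm_compContinuousLinearMap_le _ _).trans (le_of_eq ?_)
  rw [Finset.prod_const, Finset.card_univ, Fintype.card_fin,
    norm_iteratedFDerivWithin_eq_norm_iteratedDerivWithin, iteratedDerivWithin_legendreQ n j hx,
    Real.norm_eq_abs]

/-- The points at which all linear forms `ℓ i` exceed `1` and grow at least like `r i`. -/
def coerciveSet (ℓ : ι → X →L[ℝ] ℝ) (r : ι → ℝ) : Set X :=
  {x | (∀ i, 1 < ℓ i x) ∧ ∃ c > 0, ∀ i, c * r i ≤ ℓ i x}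

variable {ℓ : ι → X →L[ℝ] ℝ} {r : ι → ℝ} {M : ℝ}

/-- The radius c/(2M) serves all i at once: each ℓ i moves by at most M r_i ‖y - x‖ ≤ (c/2) r_i. -/
theorem eventually_coercive (hM : 0 < M) (hr : ∀ i, 0 < r i) (hℓ : ∀ i, ‖ℓ i‖ ≤ M * r i)
    {x : X} {c : ℝ} (hc : 0 < c) (h : ∀ i, c * r i ≤ ℓ i x) :
    ∀ᶠ y in 𝓝 x, ∀ i, c / 2 * r i ≤ ℓ i y := by
  filter_upwards [Metric.ball_mem_nhds x (show 0 < c / (2 * M) by positivity)] with y hy i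
  have h1 : ‖ℓ i (y - x)‖ ≤ M * r i * (c / (2 * M)) := by
    refine ((ℓ i).le_opNorm _).trans ?_
    have : ‖y - x‖ ≤ c / (2 * M) := by
      rw [← dist_eq_norm]
      exact (Metric.mem_ball.1 hy).le
    have := hr i
    gcongr
    exact hℓ i
  have h2 : M * r i * (c / (2 * M)) = c / 2 * r i := by field_simp
  rw [h2, map_sub, Real.norm_eq_abs, abs_le] at h1
  linarith [h i, h1.1]

theorem eventually_cofinite_le {p : ℕ} (hr : ∀ i, 0 < r i)
    (hs : Summable fun i => (r i)⁻¹ ^ (p + 1)) (K : ℝ) : ∀ᶠ i in cofinite, K ≤ r i := by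
  have hK : 0 < (max K 1)⁻¹ := by positivity
  filter_upwards [hs.tendsto_cofinite_zero.eventually_lt_const (pow_pos hK (p + 1))] with i hi
  have := lt_of_pow_lt_pow_left₀ _ hK.le hi
  exact (le_max_left _ _).trans (inv_lt_inv₀ (hr i) (by positivity) |>.1 this).le

/-- Summability forces r_i ≥ 4/c for all but finitely many i, and then coercivity alone gives ℓ i y
≥ 2. The finitely many other conditions are open by continuity. -/
theorem isOpen_coerciveSet {p : ℕ} (hM : 0 < M) (hr : ∀ i, 0 < r i) (hℓ : ∀ i, ‖ℓ i‖ ≤ M * r i)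
    (hs : Summable fun i => (r i)⁻¹ ^ (p + 1)) : IsOpen (coerciveSet ℓ r) := by
  rw [isOpen_iff_mem_nhds]
  rintro x ⟨h1, c, hc, h⟩
  have hfin := eventually_cofinite_le hr hs (2 * 2 / c)
  have h2 := (eventually_all_finite (Filter.eventually_cofinite.1 hfin)).2 fun i _ =>
    ((ℓ i).continuous.continuousAt (x := x)).eventually_const_lt (h1 i)
  filter_upwards [h2, eventually_coercive hM hr hℓ hc h] with y hy hy'
  refine ⟨fun i => ?_, c / 2, by positivity, hy'⟩
  by_cases hi : 2 * 2 / c ≤ r i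
  · have := hy' i
    rw [div_le_iff₀ hc] at hi
    linarith
  · exact hy i hi

/-- For large r_i the decay r_i^{-(n+1+j)} of Q_n^{(j)} meets the factor r_i^j from the chain rule,
so every order of derivative is dominated by r_i^{-(n+1)}. The finitely many small r_i are handled
by continuity at x. -/
theorem summableSmoothOn_legendreQ {n : ℕ} (hM : 0 < M) (hr : ∀ i, 0 < r i)
    (hℓ : ∀ i, ‖ℓ i‖ ≤ M * r i) (hs : Summable fun i => (r i)⁻¹ ^ (n + 1)) :
    SummableSmoothOn (fun i x => legendreQ n 0 (ℓ i x)) (coerciveSet ℓ r) where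
  contDiffOn i := (contDiffOn_legendreQ n 0).comp (ℓ i).contDiff.contDiffOn fun x hx => hx.1 i
  bound x hx j := by
    classical
    obtain ⟨c, hc, h⟩ := hx.2
    obtain ⟨C, hC, hQ⟩ := abs_legendreQ_le n j
    have hopen := isOpen_coerciveSet hM hr hℓ hs
    have hfin := Filter.eventually_cofinite.1 (eventually_cofinite_le hr hs (2 * 2 / c))
    set f : ι → X → ℝ := fun i x => legendreQ n 0 (ℓ i x) with hf
    have hsm : ∀ i, ContDiffOn ℝ ∞ (f i) (coerciveSet ℓ r) := fun i =>
      (contDiffOn_legendreQ n 0).comp (ℓ i).contDiff.contDiffOn fun x hx => hx.1 i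
    have h2 := (eventually_all_finite hfin).2 fun i _ =>
      eventually_norm_iteratedFDeriv_le hopen (hsm i) hx j
    set K : ℝ := C * (2 / c) ^ (n + 1 + j) * M ^ j with hK
    refine ⟨fun i => K * (r i)⁻¹ ^ (n + 1) +
      hfin.toFinset.piecewise (fun i => ‖iteratedFDeriv ℝ j (f i) x‖ + 1) 0 i,
      (hs.mul_left _).add ?_, ?_⟩
    · exact summable_of_ne_finset_zero (s := hfin.toFinset) fun i hi => by
        rw [Finset.piecewise_eq_of_notMem _ _ _ hi]; rfl
    · filter_upwards [h2, eventually_coercive hM hr hℓ hc h, hopen.mem_nhds hx] with y hy hy' hyU i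
      have hri := hr i
      by_cases hi : 2 * 2 / c ≤ r i
      · rw [Finset.piecewise_eq_of_notMem _ _ _ (by simpa using hi)]
        have hge : 2 ≤ c / 2 * r i := by
          rw [div_le_iff₀ hc] at hi
          linarith
        have h3 := hQ _ (hge.trans (hy' i))
        have h4 : (ℓ i y)⁻¹ ≤ 2 / c * (r i)⁻¹ := by
          have : 2 / c * (r i)⁻¹ = (c / 2 * r i)⁻¹ := by field_simp
          rw [this]
          exact inv_anti₀ (by positivity) (hy' i)
        have h5 : 0 ≤ (ℓ i y)⁻¹ := inv_nonneg.2 (by linarith [hyU.1 i])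
        calc ‖iteratedFDeriv ℝ j (f i) y‖ ≤ |legendreQ n j (ℓ i y)| * ‖ℓ i‖ ^ j :=
              norm_iteratedFDeriv_legendreQ_comp_le n j (ℓ i) (hyU.1 i)
          _ ≤ C * (2 / c * (r i)⁻¹) ^ (n + 1 + j) * (M * r i) ^ j := by
              refine mul_le_mul (h3.trans ?_) ?_ (by positivity) (by positivity)
              · gcongr
              · gcongr
                exact hℓ i
          _ = K * (r i)⁻¹ ^ (n + 1) + 0 := by
              rw [hK, mul_pow, mul_pow, pow_add (r i)⁻¹]
              have : (r i)⁻¹ ^ j * r i ^ j = 1 := by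
                rw [← mul_pow, inv_mul_cancel₀ hri.ne', one_pow]
              linear_combination C * (2 / c) ^ (n + 1 + j) * (r i)⁻¹ ^ (n + 1) * M ^ j * this
      · rw [Finset.piecewise_eq_of_mem _ _ _ (by simpa using hi)]
        refine (hy i hi).trans (le_add_of_nonneg_left ?_)
        positivity

end Series

/-! ### Distances between translates under the modular group -/

theorem det_eq_one (γ : SL(2, ℤ)) : (γ 0 0 : ℝ) * γ 1 1 - γ 0 1 * γ 1 0 = 1 := by
  have := γ.det_coe
  rw [Matrix.det_fin_two] at this
  exact_mod_cast this

theorem dist_smul_modular (γ : SL(2, ℤ)) (z w : ℍ) : dist (γ • z) (γ • w) = dist z w := by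
  change dist ((Matrix.SpecialLinearGroup.map (Int.castRingHom ℝ) γ) • z)
    ((Matrix.SpecialLinearGroup.map (Int.castRingHom ℝ) γ) • w) = _
  exact dist_smul _ _ _

theorem coe_smul_modular (γ : SL(2, ℤ)) (z : ℍ) :
    ((γ • z : ℍ) : ℂ) = (γ 0 0 * z + γ 0 1) / (γ 1 0 * z + γ 1 1) := by
  rw [coe_specialLinearGroup_apply]
  simp

theorem im_smul_modular (γ : SL(2, ℤ)) (z : ℍ) :
    (γ • z).im = z.im / ((γ 1 0 * z.re + γ 1 1) ^ 2 + γ 1 0 ^ 2 * z.im ^ 2) := by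
  rw [ModularGroup.im_smul_eq_div_normSq, ModularGroup.denom_apply, Complex.normSq_apply]
  congr 1
  simp
  ring

theorem modular_denom_pos (γ : SL(2, ℤ)) (z : ℍ) :
    0 < (γ 1 0 * z.re + γ 1 1) ^ 2 + (γ 1 0 : ℝ) ^ 2 * z.im ^ 2 := by
  by_contra! h
  have h1 : (γ 1 0 : ℝ) ^ 2 * z.im ^ 2 = 0 := by
    nlinarith [sq_nonneg (γ 1 0 * z.re + γ 1 1 : ℝ),
      mul_nonneg (sq_nonneg (γ 1 0 : ℝ)) (sq_nonneg z.im)]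
  have h2 : (γ 1 0 : ℝ) = 0 := by simpa [z.im_ne_zero] using h1
  have h3 : (γ 1 1 : ℝ) ^ 2 ≤ 0 := by simpa [h2] using h
  have h4 := det_eq_one γ
  have h5 : (γ 1 1 : ℝ) = 0 := by nlinarith
  simp [h2, h5] at h4

/-- The factor |cz + d|² cancels between the squared distance and Im γz, and the determinant
condition removes the remaining cross term. -/
theorem cosh_dist_smul (γ : SL(2, ℤ)) (z w : ℍ) :
    Real.cosh (dist (γ • z) w) =
      ((γ 0 0 * z.re + γ 0 1 - w.re * (γ 1 0 * z.re + γ 1 1)) ^ 2 +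
        (γ 0 0 - w.re * γ 1 0) ^ 2 * z.im ^ 2 +
        w.im ^ 2 * ((γ 1 0 * z.re + γ 1 1) ^ 2 + γ 1 0 ^ 2 * z.im ^ 2)) /
      (2 * z.im * w.im) := by
  have hC : (γ 1 0 * (z : ℂ) + γ 1 1) ≠ 0 := by
    intro h
    have h1 := modular_denom_pos γ z
    have h2 := congrArg Complex.normSq h
    rw [Complex.normSq_apply] at h2
    simp at h2
    nlinarith
  have hn : Complex.normSq (γ 1 0 * (z : ℂ) + γ 1 1) =
      (γ 1 0 * z.re + γ 1 1) ^ 2 + γ 1 0 ^ 2 * z.im ^ 2 := by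
    rw [Complex.normSq_apply]; simp; ring
  have hd := modular_denom_pos γ z
  rw [cosh_dist, Complex.dist_eq, coe_smul_modular, im_smul_modular, div_sub' hC, norm_div, div_pow,
    ← Complex.normSq_eq_norm_sq, ← Complex.normSq_eq_norm_sq, hn]
  have hm : Complex.normSq (γ 0 0 * (z : ℂ) + γ 0 1 - (γ 1 0 * z + γ 1 1) * w) =
      (γ 0 0 * z.re + γ 0 1 - w.re * (γ 1 0 * z.re + γ 1 1) + w.im * γ 1 0 * z.im) ^ 2 +
      (γ 0 0 * z.im - w.re * γ 1 0 * z.im - w.im * (γ 1 0 * z.re + γ 1 1)) ^ 2 := by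
    rw [Complex.normSq_apply]; simp; ring
  rw [hm]
  have hz := z.im_ne_zero
  have hw := w.im_ne_zero
  generalize hD : (γ 1 0 * z.re + γ 1 1) ^ 2 + (γ 1 0 : ℝ) ^ 2 * z.im ^ 2 = D at *
  field_simp
  rw [← hD]
  linear_combination (-2) * z.im * w.im * det_eq_one γ

/-- The coordinates `(|z| ^ 2, x, 1) / y` of `z = x + i y`. -/
def heightVec (z : ℂ) : Fin 3 → ℝ := ![(z.re ^ 2 + z.im ^ 2) / z.im, z.re / z.im, 1 / z.im]

theorem contDiffOn_heightVec : ContDiffOn ℝ ∞ heightVec {z | 0 < z.im} := by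
  have hre : ContDiff ℝ ∞ Complex.re := Complex.reCLM.contDiff
  have him : ContDiff ℝ ∞ Complex.im := Complex.imCLM.contDiff
  refine contDiffOn_pi.2 fun i => ?_
  have h : ∀ g : ℂ → ℝ, ContDiff ℝ ∞ g → ContDiffOn ℝ ∞ (fun z => g z / z.im) {z | 0 < z.im} :=
    fun g hg => hg.contDiffOn.div him.contDiffOn fun z hz => (Set.mem_ofPred.1 hz).ne'
  fin_cases i
  · exact h _ ((hre.pow 2).add (him.pow 2))
  · exact h _ hre
  · exact h _ contDiff_const

/-- The products of the coordinates of `z` and `w`. -/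
def heightTensor (z w : ℂ) : Fin 3 → Fin 3 → ℝ := fun i j => heightVec z i * heightVec w j

/-- The coefficients of `cosh dist (γ z) w` as a linear form in `heightTensor z w`. -/
def modularCoeff (γ : SL(2, ℤ)) : Fin 3 → Fin 3 → ℝ :=
  ![![γ 1 0 ^ 2 / 2, -(γ 0 0 * γ 1 0), γ 0 0 ^ 2 / 2],
    ![γ 1 0 * γ 1 1, -(γ 0 0 * γ 1 1 + γ 0 1 * γ 1 0), γ 0 0 * γ 0 1],
    ![γ 1 1 ^ 2 / 2, -(γ 0 1 * γ 1 1), γ 0 1 ^ 2 / 2]]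

/-- The linear form with coefficients `modularCoeff γ`. -/
def modularLinearForm (γ : SL(2, ℤ)) : (Fin 3 → Fin 3 → ℝ) →L[ℝ] ℝ :=
  ∑ i, ∑ j, modularCoeff γ i j •
    ((ContinuousLinearMap.proj j : (Fin 3 → ℝ) →L[ℝ] ℝ).comp (ContinuousLinearMap.proj i))

theorem modularLinearForm_apply (γ : SL(2, ℤ)) (v : Fin 3 → Fin 3 → ℝ) :
    modularLinearForm γ v = ∑ i, ∑ j, modularCoeff γ i j * v i j := by
  simp [modularLinearForm]

/-- The sum of the squares of the entries of `γ`. -/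
def entryNorm (γ : SL(2, ℤ)) : ℝ := γ 0 0 ^ 2 + γ 0 1 ^ 2 + γ 1 0 ^ 2 + γ 1 1 ^ 2

theorem entryNorm_pos (γ : SL(2, ℤ)) : 0 < entryNorm γ := by
  have := det_eq_one γ
  unfold entryNorm
  nlinarith [sq_nonneg (γ 0 0 - γ 1 1 : ℝ), sq_nonneg (γ 0 1 + γ 1 0 : ℝ)]

theorem abs_modularCoeff_le (γ : SL(2, ℤ)) (i j : Fin 3) : |modularCoeff γ i j| ≤ entryNorm γ := by
  unfold entryNorm
  generalize ha : (γ 0 0 : ℝ) = a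
  generalize hb : (γ 0 1 : ℝ) = b
  generalize hc : (γ 1 0 : ℝ) = c
  generalize hd : (γ 1 1 : ℝ) = d
  rw [abs_le]
  fin_cases i <;> fin_cases j <;> simp [modularCoeff, ha, hb, hc, hd] <;> constructor <;>
    linarith [sq_nonneg (a + b), sq_nonneg (a - b), sq_nonneg (c + d), sq_nonneg (c - d),
      sq_nonneg (a + c), sq_nonneg (a - c), sq_nonneg (b + d), sq_nonneg (b - d),
      sq_nonneg (a + d), sq_nonneg (a - d), sq_nonneg (b + c), sq_nonneg (b - c),
      sq_nonneg a, sq_nonneg b, sq_nonneg c, sq_nonneg d]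

theorem norm_modularLinearForm_le (γ : SL(2, ℤ)) : ‖modularLinearForm γ‖ ≤ 9 * entryNorm γ := by
  have h0 := entryNorm_pos γ
  refine ContinuousLinearMap.opNorm_le_bound _ (by positivity) fun v => ?_
  rw [modularLinearForm_apply]
  have h : ∀ i j, ‖modularCoeff γ i j * v i j‖ ≤ entryNorm γ * ‖v‖ := fun i j => by
    rw [norm_mul, Real.norm_eq_abs]
    exact mul_le_mul (abs_modularCoeff_le γ i j) ((norm_le_pi_norm (v i) j).trans
      (norm_le_pi_norm v i)) (norm_nonneg _) h0.le
  refine (norm_sum_le_of_le _ fun i _ => norm_sum_le_of_le _ fun j _ => h i j).trans (le_of_eq ?_)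
  simp
  ring

/-- This puts the Poincaré series into the framework of Legendre functions of linear forms, jointly
in z and w. -/
theorem modularLinearForm_heightTensor (γ : SL(2, ℤ)) (z w : ℍ) :
    modularLinearForm γ (heightTensor z w) = Real.cosh (dist (γ • z) w) := by
  rw [modularLinearForm_apply, cosh_dist_smul]
  have hz := z.im_ne_zero
  have hw := w.im_ne_zero
  simp [Fin.sum_univ_three, modularCoeff, heightTensor, heightVec]
  field_simp
  ring

/-- The constant depends on w alone; this uniformity in z is needed at the cusp. It compares the
forms |A - wC|² and A² + C² in real A, C, applied to the real and imaginary parts of az + b and cz +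
d. -/
theorem exists_le_cosh_dist_smul (w : ℍ) : ∃ κ > 0, ∀ (γ : SL(2, ℤ)) (z : ℍ),
    κ * (((γ 0 0 * z.re + γ 0 1) ^ 2 + (γ 1 0 * z.re + γ 1 1) ^ 2 +
      (γ 0 0 ^ 2 + γ 1 0 ^ 2) * z.im ^ 2) / z.im) ≤ Real.cosh (dist (γ • z) w) := by
  have hw := w.im_pos
  set K : ℝ := 2 + (2 * w.re ^ 2 + 1) / w.im ^ 2 with hK
  have hK0 : 0 < K := by positivity
  refine ⟨(2 * w.im * K)⁻¹, by positivity, fun γ z => ?_⟩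
  have hz := z.im_pos
  have key : ∀ A C : ℝ, A ^ 2 + C ^ 2 ≤ K * ((A - w.re * C) ^ 2 + w.im ^ 2 * C ^ 2) := by
    intro A C
    have h1 : K * ((A - w.re * C) ^ 2 + w.im ^ 2 * C ^ 2) =
        2 * (A - w.re * C) ^ 2 + (2 * w.re ^ 2 + 1) / w.im ^ 2 * (A - w.re * C) ^ 2 +
        2 * (w.im ^ 2 * C ^ 2) + (2 * w.re ^ 2 + 1) * C ^ 2 := by
      rw [hK]; field_simp; ring
    have h2 : 0 ≤ (2 * w.re ^ 2 + 1) / w.im ^ 2 * (A - w.re * C) ^ 2 := by positivity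
    rw [h1]
    nlinarith [sq_nonneg (A - 2 * (w.re * C)), sq_nonneg (w.im * C)]
  rw [cosh_dist_smul, inv_mul_le_iff₀ (by positivity), mul_div_assoc', div_le_div_iff₀ hz
    (by positivity)]
  have h1 := key (γ 0 0 * z.re + γ 0 1) (γ 1 0 * z.re + γ 1 1)
  have h2 := key (γ 0 0 * z.im) (γ 1 0 * z.im)
  have h3 : (γ 0 0 * z.re + γ 0 1 : ℝ) ^ 2 + (γ 1 0 * z.re + γ 1 1) ^ 2 +
      (γ 0 0 ^ 2 + γ 1 0 ^ 2) * z.im ^ 2 ≤ K *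
      ((γ 0 0 * z.re + γ 0 1 - w.re * (γ 1 0 * z.re + γ 1 1)) ^ 2 +
        (γ 0 0 - w.re * γ 1 0) ^ 2 * z.im ^ 2 +
        w.im ^ 2 * ((γ 1 0 * z.re + γ 1 1) ^ 2 + γ 1 0 ^ 2 * z.im ^ 2)) := by
    nlinarith
  calc _ ≤ (K *
      ((γ 0 0 * z.re + γ 0 1 - w.re * (γ 1 0 * z.re + γ 1 1)) ^ 2 +
        (γ 0 0 - w.re * γ 1 0) ^ 2 * z.im ^ 2 +
        w.im ^ 2 * ((γ 1 0 * z.re + γ 1 1) ^ 2 + γ 1 0 ^ 2 * z.im ^ 2))) *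
        (2 * z.im * w.im) := by gcongr
    _ = _ := by ring

theorem exists_entryNorm_le_cosh_dist_smul (z w : ℍ) : ∃ κ > 0, ∀ γ : SL(2, ℤ),
    κ * entryNorm γ ≤ Real.cosh (dist (γ • z) w) := by
  obtain ⟨κ, hκ, h⟩ := exists_le_cosh_dist_smul w
  have hz := z.im_pos
  set K : ℝ := 2 + (2 * z.re ^ 2 + 1) / z.im ^ 2 with hK
  have hK0 : 0 < K := by positivity
  refine ⟨κ * (z.im * K)⁻¹, by positivity, fun γ => le_trans ?_ (h γ z)⟩
  have key : ∀ a b : ℝ, a ^ 2 + b ^ 2 ≤ K * ((a * z.re + b) ^ 2 + a ^ 2 * z.im ^ 2) := by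
    intro a b
    have h1 : K * ((a * z.re + b) ^ 2 + a ^ 2 * z.im ^ 2) =
        2 * (a * z.re + b) ^ 2 + (2 * z.re ^ 2 + 1) / z.im ^ 2 * (a * z.re + b) ^ 2 +
        2 * (a ^ 2 * z.im ^ 2) + (2 * z.re ^ 2 + 1) * a ^ 2 := by
      rw [hK]; field_simp; ring
    have h2 : 0 ≤ (2 * z.re ^ 2 + 1) / z.im ^ 2 * (a * z.re + b) ^ 2 := by positivity
    rw [h1]
    nlinarith [sq_nonneg (2 * (a * z.re) + b), sq_nonneg (a * z.im)]
  rw [mul_assoc]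
  gcongr
  rw [inv_mul_le_iff₀ (by positivity), mul_div_assoc', le_div_iff₀ hz]
  have h1 := key (γ 0 0) (γ 0 1)
  have h2 := key (γ 1 0) (γ 1 1)
  unfold entryNorm
  nlinarith

/-! ### Summation over the modular group -/

/-- The first column of `γ` together with the position of the second column along it. -/
def modularIndex (γ : SL(2, ℤ)) : (Fin 2 → ℤ) × ℤ :=
  (![γ 0 0, γ 1 0], (γ 0 0 * γ 0 1 + γ 1 0 * γ 1 1) / (γ 0 0 ^ 2 + γ 1 0 ^ 2))

theorem det_eq_one_int (γ : SL(2, ℤ)) : γ 0 0 * γ 1 1 - γ 0 1 * γ 1 0 = 1 := by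
  have := γ.det_coe
  rwa [Matrix.det_fin_two] at this

theorem one_le_column (γ : SL(2, ℤ)) : 1 ≤ γ 0 0 ^ 2 + γ 1 0 ^ 2 := by
  have h := det_eq_one_int γ
  by_contra! h1
  have h2 : γ 0 0 = 0 := by nlinarith [sq_nonneg (γ 0 0), sq_nonneg (γ 1 0)]
  have h3 : γ 1 0 = 0 := by nlinarith [sq_nonneg (γ 0 0), sq_nonneg (γ 1 0)]
  simp [h2, h3] at h

theorem modularIndex_injective : Function.Injective modularIndex := by
  intro γ γ' h
  simp only [modularIndex, Prod.mk.injEq] at h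
  obtain ⟨h1, h2⟩ := h
  have ha : γ 0 0 = γ' 0 0 := by simpa using congrFun h1 0
  have hc : γ 1 0 = γ' 1 0 := by simpa using congrFun h1 1
  have hR := one_le_column γ
  have hd := det_eq_one_int γ
  have hd' := det_eq_one_int γ'
  rw [← ha, ← hc] at hd' h2
  set j := γ 1 1 * (γ 0 1 - γ' 0 1) - γ 0 1 * (γ 1 1 - γ' 1 1) with hj
  have e1 : γ 0 1 - γ' 0 1 = γ 0 0 * j := by
    rw [hj]; linear_combination (-(γ 0 1 - γ' 0 1)) * hd + γ 0 1 * (hd - hd')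
  have e2 : γ 1 1 - γ' 1 1 = γ 1 0 * j := by
    rw [hj]; linear_combination (-(γ 1 1 - γ' 1 1)) * hd + γ 1 1 * (hd - hd')
  have e3 : γ 0 0 * γ 0 1 + γ 1 0 * γ 1 1 =
      (γ 0 0 * γ' 0 1 + γ 1 0 * γ' 1 1) + j * (γ 0 0 ^ 2 + γ 1 0 ^ 2) := by
    linear_combination γ 0 0 * e1 + γ 1 0 * e2
  rw [e3, Int.add_mul_ediv_right _ _ (by omega)] at h2
  have hj0 : j = 0 := by omega
  rw [hj0, mul_zero] at e1 e2
  ext i k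
  fin_cases i <;> fin_cases k
  · exact ha
  · exact sub_eq_zero.1 e1
  · exact hc
  · exact sub_eq_zero.1 e2

/-- With R = a² + c² and m = ab + cd, completing the square gives (ax + b)² + (cx + d)² = R(x +
m/R)² + 1/R. The index n is the floor of m/R, so s = x + m/R satisfies |s| ≥ |n| - 3/2. -/
theorem modularIndex_bound (γ : SL(2, ℤ)) {x y : ℝ} (hx : |x| ≤ 1 / 2) (hy : 1 ≤ y) :
    (γ 0 0 ^ 2 + γ 1 0 ^ 2 : ℝ) * (1 + |((modularIndex γ).2 : ℝ)|) / 4 ≤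
      ((γ 0 0 * x + γ 0 1) ^ 2 + (γ 1 0 * x + γ 1 1) ^ 2 +
        (γ 0 0 ^ 2 + γ 1 0 ^ 2) * y ^ 2) / y := by
  have hR1 : (1 : ℝ) ≤ γ 0 0 ^ 2 + γ 1 0 ^ 2 := by exact_mod_cast one_le_column γ
  set R : ℝ := γ 0 0 ^ 2 + γ 1 0 ^ 2 with hR
  set m : ℝ := γ 0 0 * γ 0 1 + γ 1 0 * γ 1 1 with hm
  set n : ℤ := (modularIndex γ).2 with hn
  have hRi : 0 < γ 0 0 ^ 2 + γ 1 0 ^ 2 := by have := one_le_column γ; omega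
  have h1 : (n : ℝ) * R ≤ m := by
    have := Int.ediv_mul_le (γ 0 0 * γ 0 1 + γ 1 0 * γ 1 1) hRi.ne'
    rw [hR, hm, hn]
    exact_mod_cast this
  have h2 : m ≤ (n + 1) * R := by
    have := (Int.lt_ediv_add_one_mul_self (γ 0 0 * γ 0 1 + γ 1 0 * γ 1 1) hRi).le
    rw [hR, hm, hn]
    exact_mod_cast this
  have hy0 : 0 < y := by linarith
  have hid : (γ 0 0 * x + γ 0 1 : ℝ) ^ 2 + (γ 1 0 * x + γ 1 1) ^ 2 =
      (R * (x + m / R) ^ 2) + 1 / R := by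
    have := det_eq_one γ
    field_simp
    rw [hR, hm]
    linear_combination ((γ 0 0 * γ 1 1 - γ 0 1 * γ 1 0 : ℝ) + 1) * this
  set s := x + m / R with hs
  have hs1 : (n : ℝ) - 1 / 2 ≤ s := by
    have : (n : ℝ) ≤ m / R := by rwa [le_div_iff₀ (by linarith)]
    linarith [(abs_le.1 hx).1]
  have hs2 : s ≤ n + 3 / 2 := by
    have : m / R ≤ n + 1 := by rwa [div_le_iff₀ (by linarith)]
    linarith [(abs_le.1 hx).2]
  have hs3 : |(n : ℝ)| - 3 / 2 ≤ |s| := by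
    rcases abs_cases (n : ℝ) with h | h <;> rcases abs_cases s with h' | h' <;> linarith
  -- For |n| ≤ 2 the term y² ≥ y suffices; for |n| ≥ 3 the inequality s² + y² ≥ 2|s|y does.
  have hint : |(n : ℝ)| ≤ 2 ∨ 3 ≤ |(n : ℝ)| := by
    rcases le_or_gt |n| 2 with h | h
    · left; exact_mod_cast h
    · right; exact_mod_cast h
  have h5 : (1 + |(n : ℝ)|) / 4 * y ≤ s ^ 2 + y ^ 2 := by
    rw [← sq_abs s]
    rcases hint with h | h
    · nlinarith [sq_nonneg |s|]
    · nlinarith [sq_nonneg (|s| - y)]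
  rw [hid, le_div_iff₀ hy0]
  have h6 : 0 ≤ 1 / R := by positivity
  nlinarith

theorem modularIndex_norm_le (γ : SL(2, ℤ)) :
    ‖(modularIndex γ).1‖ ^ 2 ≤ (γ 0 0 ^ 2 + γ 1 0 ^ 2 : ℝ) := by
  have h : ‖(modularIndex γ).1‖ ≤ √(γ 0 0 ^ 2 + γ 1 0 ^ 2 : ℝ) := by
    refine (pi_norm_le_iff_of_nonneg (Real.sqrt_nonneg _)).2 fun i => ?_
    rw [Int.norm_eq_abs]
    refine Real.abs_le_sqrt ?_
    fin_cases i
    · simp [modularIndex]; positivity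
    · simp [modularIndex]; positivity
  calc _ ≤ √(γ 0 0 ^ 2 + γ 1 0 ^ 2 : ℝ) ^ 2 := by gcongr
    _ = _ := Real.sq_sqrt (by positivity)

/-- A summable majorant of the `(p + 1)`-st powers of the inverses of `cosh dist (γ z) w`. -/
def modularMajorant (p : ℕ) (γ : SL(2, ℤ)) : ℝ :=
  ((γ 0 0 ^ 2 + γ 1 0 ^ 2 : ℝ) * (1 + |((modularIndex γ).2 : ℝ)|))⁻¹ ^ (p + 1)

/-- The index embeds the group in ℤ² × ℤ, where the majorant is bounded by the product of an
Eisenstein series of exponent 2(p + 1) > 2 and a series of exponent p + 1 > 1. The condition k ≥ 2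
enters here. -/
theorem summable_modularMajorant {p : ℕ} (hp : 1 ≤ p) : Summable (modularMajorant p) := by
  have h1 : Summable fun v : Fin 2 → ℤ => (‖v‖ ^ 2)⁻¹ ^ (p + 1) := by
    have := EisensteinSeries.summable_one_div_norm_rpow (k := (2 * (p + 1) : ℕ)) (by
      have : (1 : ℝ) ≤ p := by exact_mod_cast hp
      push_cast
      linarith)
    refine this.congr fun v => ?_
    rw [Real.rpow_neg (norm_nonneg _), Real.rpow_natCast, pow_mul, inv_pow]
  have h2 : Summable fun n : ℤ => (1 + |(n : ℝ)|)⁻¹ ^ (p + 1) := by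
    have h3 : Summable fun n : ℕ => ((n : ℝ) + 1)⁻¹ ^ (p + 1) := by
      have := (summable_nat_add_iff 1).2 (Real.summable_nat_pow_inv (p := p + 1)|>.2 (by omega))
      simpa [inv_pow] using this
    refine Summable.of_nat_of_neg (h3.congr fun n => ?_) (h3.congr fun n => ?_)
    · simp [add_comm]
    · simp [add_comm]
  have h3 := (h1.mul_of_nonneg h2 (fun _ => by positivity) (fun _ => by positivity)).comp_injective
    modularIndex_injective
  refine h3.of_nonneg_of_le (fun γ => by unfold modularMajorant; positivity) fun γ => ?_
  rw [modularMajorant, Function.comp, ← mul_pow, ← mul_inv]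
  have hv : 0 < ‖(modularIndex γ).1‖ := by
    rw [norm_pos_iff]
    intro h
    have ha : γ 0 0 = 0 := by simpa [modularIndex] using congrFun h 0
    have hc : γ 1 0 = 0 := by simpa [modularIndex] using congrFun h 1
    have := one_le_column γ
    simp [ha, hc] at this
  gcongr
  exact modularIndex_norm_le γ

theorem column_pos (γ : SL(2, ℤ)) : (0 : ℝ) < γ 0 0 ^ 2 + γ 1 0 ^ 2 := by
  have : (1 : ℝ) ≤ γ 0 0 ^ 2 + γ 1 0 ^ 2 := by exact_mod_cast one_le_column γ
  linarith

theorem summable_entryNorm {p : ℕ} (hp : 1 ≤ p) :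
    Summable fun γ : SL(2, ℤ) => (entryNorm γ)⁻¹ ^ (p + 1) := by
  refine ((summable_modularMajorant hp).mul_left (4 ^ (p + 1))).of_nonneg_of_le
    (fun γ => pow_nonneg (inv_nonneg.2 (entryNorm_pos γ).le) _) fun γ => ?_
  -- At z = i the right side of the bound is the entry norm.
  have h := modularIndex_bound γ (x := 0) (y := 1) (by norm_num) le_rfl
  have hc := column_pos γ
  rw [modularMajorant, ← mul_pow]
  have h0 := entryNorm_pos γ
  have e : (4 : ℝ) * ((γ 0 0 ^ 2 + γ 1 0 ^ 2 : ℝ) * (1 + |((modularIndex γ).2 : ℝ)|))⁻¹ =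
      ((γ 0 0 ^ 2 + γ 1 0 ^ 2 : ℝ) * (1 + |((modularIndex γ).2 : ℝ)|) / 4)⁻¹ := by
    rw [inv_div]
    rfl
  rw [e]
  gcongr
  refine h.trans (le_of_eq ?_)
  unfold entryNorm
  ring

/-! ### Laplacians and raising operators of series -/

theorem laplacian_eq_fderiv_fderiv (f : ℂ → ℝ) (z : ℂ) :
    Laplacian.laplacian f z =
      fderiv ℝ (fderiv ℝ f) z 1 1 + fderiv ℝ (fderiv ℝ f) z Complex.I Complex.I := by
  rw [InnerProductSpace.laplacian_eq_iteratedFDeriv_complexPlane]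
  simp [iteratedFDeriv_two_apply]

/-- The trace of a bilinear form on `ℂ` as a continuous linear map. -/
def complexTrace : (ℂ →L[ℝ] ℂ →L[ℝ] ℝ) →L[ℝ] ℝ :=
  ((ContinuousLinearMap.apply ℝ ℝ (1 : ℂ)).comp (ContinuousLinearMap.apply ℝ (ℂ →L[ℝ] ℝ) (1 : ℂ))) +
    (ContinuousLinearMap.apply ℝ ℝ Complex.I).comp
      (ContinuousLinearMap.apply ℝ (ℂ →L[ℝ] ℝ) Complex.I)

theorem laplacian_eq_complexTrace (f : ℂ → ℝ) (z : ℂ) :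
    Laplacian.laplacian f z = complexTrace (fderiv ℝ (fderiv ℝ f) z) := by
  rw [laplacian_eq_fderiv_fderiv]
  simp [complexTrace]

theorem laplacian_tsum {ι : Type} {f : ι → ℂ → ℝ} {U : Set ℂ} (hU : IsOpen U)
    (h : SummableSmoothOn f U) {z : ℂ} (hz : z ∈ U) :
    Laplacian.laplacian (fun y => ∑' i, f i y) z = ∑' i, Laplacian.laplacian (f i) z := by
  have h1 : fderiv ℝ (fun y => ∑' i, f i y) =ᶠ[𝓝 z] fun y => ∑' i, fderiv ℝ (f i) y := by
    filter_upwards [hU.mem_nhds hz] with y hy using (h.hasFDerivAt_tsum hU hy).fderiv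
  rw [laplacian_eq_complexTrace, h1.fderiv_eq, ((h.fderiv hU).hasFDerivAt_tsum hU hz).fderiv,
    complexTrace.map_tsum (((h.fderiv hU).fderiv hU).summable hz)]
  simp only [laplacian_eq_complexTrace]

/-- `F' ↦ 2 i ∂F/∂z` as a continuous linear map. -/
def wirtingerCLM : (ℂ →L[ℝ] ℂ) →L[ℝ] ℂ :=
  Complex.I • (ContinuousLinearMap.apply ℝ ℂ (1 : ℂ) -
    Complex.I • ContinuousLinearMap.apply ℝ ℂ Complex.I)

theorem raise_eq (κ : ℤ) (F : ℂ → ℂ) (z : ℂ) :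
    raise κ F z = wirtingerCLM (fderiv ℝ F z) + κ * (z.im : ℂ)⁻¹ * F z := by
  simp only [raise, dz, wirtingerCLM]
  simp
  ring

theorem raise_congr {κ : ℤ} {F G : ℂ → ℂ} {z : ℂ} (h : F =ᶠ[𝓝 z] G) :
    raise κ F z = raise κ G z := by
  rw [raise_eq, raise_eq, h.fderiv_eq, h.eq_of_nhds]

theorem raiseIter_congr {κ : ℤ} {n : ℕ} {F G : ℂ → ℂ} {U : Set ℂ} (hU : IsOpen U)
    (h : Set.EqOn F G U) : Set.EqOn (raiseIter κ n F) (raiseIter κ n G) U := by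
  induction n with
  | zero => exact h
  | succ n ih =>
    intro z hz
    exact raise_congr (ih.eventuallyEq_of_mem (hU.mem_nhds hz))

theorem SummableSmoothOn.raise {ι : Type} {f : ι → ℂ → ℂ} {U : Set ℂ} (hU : IsOpen U)
    (hpos : ∀ z ∈ U, 0 < z.im) (h : SummableSmoothOn f U) (κ : ℤ) :
    SummableSmoothOn (fun i => HigherGreen.raise κ (f i)) U := by
  have hg : ContDiffOn ℝ ∞ (fun z : ℂ => (κ : ℂ) * (z.im : ℂ)⁻¹) U := by
    refine contDiffOn_const.mul (ContDiffOn.inv ?_ fun z hz => ?_)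
    · exact (Complex.ofRealCLM.comp Complex.imCLM).contDiff.contDiffOn
    · exact_mod_cast (hpos z hz).ne'
  have := ((h.fderiv hU).clm_comp hU wirtingerCLM).add hU (h.const_mul hU hg)
  refine (funext₂ fun i z => ?_ : (fun i => HigherGreen.raise κ (f i)) = _) ▸ this
  exact raise_eq κ (f i) z

theorem SummableSmoothOn.raiseIter {ι : Type} {f : ι → ℂ → ℂ} {U : Set ℂ} (hU : IsOpen U)
    (hpos : ∀ z ∈ U, 0 < z.im) (h : SummableSmoothOn f U) (κ : ℤ) (n : ℕ) :
    SummableSmoothOn (fun i => HigherGreen.raiseIter κ n (f i)) U := by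
  induction n with
  | zero => exact h
  | succ n ih => exact ih.raise hU hpos _

theorem raise_tsum {ι : Type} {f : ι → ℂ → ℂ} {U : Set ℂ} (hU : IsOpen U)
    (h : SummableSmoothOn f U) (κ : ℤ) {z : ℂ} (hz : z ∈ U) :
    raise κ (fun y => ∑' i, f i y) z = ∑' i, raise κ (f i) z := by
  have hs := (h.fderiv hU).summable hz
  simp only [raise_eq]
  rw [(h.hasFDerivAt_tsum hU hz).fderiv, wirtingerCLM.map_tsum hs, ← tsum_mul_left,
    Summable.tsum_add (wirtingerCLM.summable hs) ((h.summable hz).mul_left _)]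

theorem raiseIter_tsum {ι : Type} {f : ι → ℂ → ℂ} {U : Set ℂ} (hU : IsOpen U)
    (hpos : ∀ z ∈ U, 0 < z.im) (h : SummableSmoothOn f U) (κ : ℤ) (n : ℕ) :
    Set.EqOn (raiseIter κ n fun y => ∑' i, f i y) (fun z => ∑' i, raiseIter κ n (f i) z) U := by
  induction n with
  | zero => exact fun z _ => rfl
  | succ n ih =>
    intro z hz
    simp only [raiseIter]
    rw [raise_congr (ih.eventuallyEq_of_mem (hU.mem_nhds hz))]
    exact raise_tsum hU (h.raiseIter hU hpos κ n) _ hz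

/-! ### Functions of `(A |z| ^ 2 + B x + C) / y` -/

/-- `(A |z| ^ 2 + B x + C) / y`. -/
def quadHeight (A B C : ℝ) (z : ℂ) : ℝ := (A * (z.re ^ 2 + z.im ^ 2) + B * z.re + C) / z.im

theorem hasDerivAt_line {f : ℂ → ℝ} {z : ℂ} (e : ℂ) (hf : ContDiffAt ℝ 2 f z) :
    (∀ᶠ s : ℝ in 𝓝 0, HasDerivAt (fun s : ℝ => f (z + s * e)) (fderiv ℝ f (z + s * e) e) s) ∧
      HasDerivAt (fun s : ℝ => fderiv ℝ f (z + s * e) e) (fderiv ℝ (fderiv ℝ f) z e e) 0 := by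
  have hline : ∀ s : ℝ, HasDerivAt (fun s : ℝ => z + s * e) e s := fun s => by
    simpa using ((Complex.ofRealCLM.hasDerivAt (x := s)).mul_const e).const_add z
  have hc : Tendsto (fun s : ℝ => z + s * e) (𝓝 0) (𝓝 z) := by
    have := (hline 0).continuousAt.tendsto
    simpa using this
  have hd : ∀ᶠ y in 𝓝 z, DifferentiableAt ℝ f y :=
    (hf.eventually (by simp)).mono fun y hy => hy.differentiableAt (by norm_num)
  have h4 : DifferentiableAt ℝ (fderiv ℝ f) z :=
    (hf.fderiv_right (m := 1) (by norm_num)).differentiableAt (by norm_num)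
  have h6 : HasFDerivAt (fderiv ℝ f) (fderiv ℝ (fderiv ℝ f) z) (z + (0 : ℝ) * e) := by
    simpa using h4.hasFDerivAt
  have h7 : HasDerivAt (fun s : ℝ => fderiv ℝ f (z + s * e)) (fderiv ℝ (fderiv ℝ f) z e) 0 :=
    h6.comp_hasDerivAt (0 : ℝ) (hline 0)
  refine ⟨?_, (ContinuousLinearMap.apply ℝ ℝ e).hasFDerivAt.comp_hasDerivAt (0 : ℝ) h7⟩
  filter_upwards [hc.eventually hd] with s hs
  exact hs.hasFDerivAt.comp_hasDerivAt s (hline s)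

/-- Reduces the diagonal second derivatives that make up the Laplacian to one-variable calculus
along lines. -/
theorem fderiv_fderiv_apply_of_line {f : ℂ → ℝ} {z e : ℂ} (hf : ContDiffAt ℝ 2 f z)
    {g : ℝ → ℝ} {g' : ℝ} (h1 : ∀ᶠ s : ℝ in 𝓝 0, HasDerivAt (fun s : ℝ => f (z + s * e)) (g s) s)
    (h2 : HasDerivAt g g' 0) : fderiv ℝ (fderiv ℝ f) z e e = g' := by
  obtain ⟨h3, h4⟩ := hasDerivAt_line e hf
  have h5 : ∀ᶠ s : ℝ in 𝓝 0, fderiv ℝ f (z + s * e) e = g s := by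
    filter_upwards [h1, h3] with s hs hs' using hs'.unique hs
  exact h4.unique (h2.congr_of_eventuallyEq h5)

theorem fderiv_fderiv_apply_nonpos_of_isLocalMax {f : ℂ → ℝ} {z : ℂ} (e : ℂ)
    (hf : ContDiffAt ℝ 2 f z) (hmax : IsLocalMax f z) : fderiv ℝ (fderiv ℝ f) z e e ≤ 0 := by
  obtain ⟨h1, h2⟩ := hasDerivAt_line e hf
  set g : ℝ → ℝ := fun s => f (z + s * e) with hg
  have hd : deriv g =ᶠ[𝓝 0] fun s => fderiv ℝ f (z + s * e) e := h1.mono fun s hs => hs.deriv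
  have hdd : deriv (deriv g) 0 = fderiv ℝ (fderiv ℝ f) z e e := by rw [hd.deriv_eq, h2.deriv]
  have hc : Tendsto (fun s : ℝ => z + s * e) (𝓝 0) (𝓝 z) := by
    have : Continuous fun s : ℝ => z + s * e := by fun_prop
    simpa using this.tendsto 0
  have hgmax : IsLocalMax g 0 := by
    have : ∀ᶠ s : ℝ in 𝓝 0, f (z + s * e) ≤ f z := hc.eventually hmax
    simpa [IsLocalMax, IsMaxFilter, hg] using this
  by_contra! hpos
  rw [← hdd] at hpos
  -- A positive second derivative would make 0 a local minimum as well, hence g locally constant,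
  -- with zero second derivative.
  have hgmin := isLocalMin_of_deriv_deriv_pos hpos hgmax.deriv_eq_zero
    h1.self_of_nhds.continuousAt
  have hconst : g =ᶠ[𝓝 0] fun _ => g 0 := by
    filter_upwards [hgmax, hgmin] with s hs hs' using le_antisymm hs hs'
  have h0 : deriv g =ᶠ[𝓝 0] fun _ => 0 := hconst.deriv.trans (by simp)
  rw [h0.deriv_eq] at hpos
  simp at hpos

theorem contDiffOn_quadHeight (A B C : ℝ) : ContDiffOn ℝ ∞ (quadHeight A B C) {z | 0 < z.im} := by
  have hre : ContDiff ℝ ∞ Complex.re := Complex.reCLM.contDiff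
  have him : ContDiff ℝ ∞ Complex.im := Complex.imCLM.contDiff
  exact ContDiffOn.div (((contDiff_const.mul ((hre.pow 2).add (him.pow 2))).add
    (contDiff_const.mul hre)).add contDiff_const).contDiffOn him.contDiffOn
    fun z hz => (Set.mem_ofPred.1 hz).ne'

theorem isOpen_im_pos : IsOpen {z : ℂ | 0 < z.im} := isOpen_lt continuous_const Complex.continuous_im

theorem isOpen_quadHeight (A B C : ℝ) : IsOpen {z : ℂ | 0 < z.im ∧ 1 < quadHeight A B C z} :=
  (contDiffOn_quadHeight A B C).continuousOn.isOpen_inter_preimage isOpen_im_pos isOpen_Ioi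

/-- For T = `quadHeight A B C` the normalization gives y²|∇T|² = T² - 1, and also y²ΔT = 2T. So y²Δ
acts on functions of T as the Legendre operator. -/
theorem laplacian_legendreQ_quadHeight (n : ℕ) {A B C : ℝ} (hd : 4 * A * C - B ^ 2 = 1) {z : ℂ}
    (hz : 0 < z.im) (hT : 1 < quadHeight A B C z) :
    z.im ^ 2 * Laplacian.laplacian (fun y => legendreQ n 0 (quadHeight A B C y)) z =
      n * (n + 1) * legendreQ n 0 (quadHeight A B C z) := by
  have hopen := isOpen_quadHeight A B C
  have hmem := hopen.mem_nhds (show z ∈ {z : ℂ | 0 < z.im ∧ 1 < quadHeight A B C z} from ⟨hz, hT⟩)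
  have hsm : ContDiffAt ℝ 2 (fun y => legendreQ n 0 (quadHeight A B C y)) z := by
    have : ContDiffOn ℝ ∞ (fun y => legendreQ n 0 (quadHeight A B C y))
        {z : ℂ | 0 < z.im ∧ 1 < quadHeight A B C z} :=
      (contDiffOn_legendreQ n 0).comp ((contDiffOn_quadHeight A B C).mono fun y hy => hy.1)
        fun y hy => hy.2
    exact contDiffAt_infty.1 (this.contDiffAt hmem) 2
  have hev : ∀ e : ℂ, ∀ᶠ s : ℝ in 𝓝 0,
      0 < (z + s * e).im ∧ 1 < quadHeight A B C (z + s * e) := fun e => by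
    have hc : Continuous fun s : ℝ => z + s * e := by fun_prop
    have : Tendsto (fun s : ℝ => z + s * e) (𝓝 0) (𝓝 z) := by simpa using hc.tendsto 0
    exact this.eventually hmem
  set T : ℝ := quadHeight A B C z with hTdef
  have hTz : T * z.im = A * (z.re ^ 2 + z.im ^ 2) + B * z.re + C := by
    rw [hTdef, quadHeight, div_mul_cancel₀ _ hz.ne']
  -- the horizontal direction
  have hX : ∀ s : ℝ, HasDerivAt (fun s : ℝ => quadHeight A B C (z + s * 1))
      ((2 * A * (z.re + s) + B) / z.im) s := fun s => by
    have h0 := (hasDerivAt_id s).const_add z.re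
    have h := ((((h0.pow 2).add_const (z.im ^ 2)).const_mul A).add (h0.const_mul B)).add_const C
      |>.div_const z.im
    have h2 := h.congr_deriv (show _ = (2 * A * (z.re + s) + B) / z.im by simp; ring)
    refine h2.congr_of_eventuallyEq (Eventually.of_forall fun s => ?_)
    simp [quadHeight]
  have hxx : fderiv ℝ (fderiv ℝ fun y => legendreQ n 0 (quadHeight A B C y)) z 1 1 =
      legendreQ n 2 T * ((2 * A * z.re + B) / z.im) ^ 2 + legendreQ n 1 T * (2 * A / z.im) := by
    refine fderiv_fderiv_apply_of_line hsm
      (g := fun s => legendreQ n 1 (quadHeight A B C (z + s * 1)) *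
        ((2 * A * (z.re + s) + B) / z.im)) ?_ ?_
    · filter_upwards [hev 1] with s hs
      have h := (hasDerivAt_legendreQ n 0 hs.2).comp s (hX s)
      exact h
    · have h0 : quadHeight A B C (z + (0 : ℝ) * 1) = T := by simp [hTdef]
      have h1 := (hasDerivAt_legendreQ n 1 (by rw [h0]; exact hT)).comp (0 : ℝ) (hX 0)
      have h2 := ((((hasDerivAt_id (0 : ℝ)).const_add z.re).const_mul (2 * A)).add_const
        B).div_const z.im
      rw [h0] at h1
      refine (h1.mul h2).congr_deriv ?_
      simp only [Function.comp_apply, id, add_zero]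
      rw [h0]
      ring
  -- the vertical direction
  have hY : ∀ s : ℝ, z.im + s ≠ 0 → HasDerivAt (fun s : ℝ => quadHeight A B C (z + s * Complex.I))
      (2 * A - quadHeight A B C (z + s * Complex.I) / (z.im + s)) s := fun s hs => by
    have h0 := (hasDerivAt_id s).const_add z.im
    have h := (((((h0.pow 2).const_add (z.re ^ 2)).const_mul A).add_const (B * z.re)).add_const C)
      |>.div h0 hs
    have e : ∀ s : ℝ, quadHeight A B C (z + s * Complex.I) =
        (A * (z.re ^ 2 + (z.im + s) ^ 2) + B * z.re + C) / (z.im + s) := fun s => by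
      simp [quadHeight]
    have h2 := h.congr_deriv
      (show _ = 2 * A - quadHeight A B C (z + s * Complex.I) / (z.im + s) by
        rw [e]; simp; field_simp)
    exact h2.congr_of_eventuallyEq (Eventually.of_forall fun s => e s)
  have hyy : fderiv ℝ (fderiv ℝ fun y => legendreQ n 0 (quadHeight A B C y)) z Complex.I Complex.I =
      legendreQ n 2 T * (2 * A - T / z.im) ^ 2 +
        legendreQ n 1 T * (-(2 * A - T / z.im) / z.im + T / z.im ^ 2) := by
    refine fderiv_fderiv_apply_of_line hsm
      (g := fun s => legendreQ n 1 (quadHeight A B C (z + s * Complex.I)) *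
        (2 * A - quadHeight A B C (z + s * Complex.I) / (z.im + s))) ?_ ?_
    · filter_upwards [hev Complex.I] with s hs
      have hs1 : z.im + s ≠ 0 := by
        have := hs.1
        simp at this
        exact this.ne'
      have h := (hasDerivAt_legendreQ n 0 hs.2).comp s (hY s hs1)
      exact h
    · have h0 : quadHeight A B C (z + (0 : ℝ) * Complex.I) = T := by simp [hTdef]
      have hz0 : z.im + 0 ≠ 0 := by simpa using hz.ne'
      have h1 := (hasDerivAt_legendreQ n 1 (by rw [h0]; exact hT)).comp (0 : ℝ) (hY 0 hz0)
      have h2 := ((hY 0 hz0).div ((hasDerivAt_id (0 : ℝ)).const_add z.im) hz0).const_sub (2 * A)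
      rw [h0] at h1
      refine (h1.mul h2).congr_deriv ?_
      simp only [Function.comp_apply, h0, id, add_zero, Pi.div_apply]
      field_simp
      ring
  rw [laplacian_eq_fderiv_fderiv, hxx, hyy, ← legendreQ_ode n hT]
  have hz' := hz.ne'
  have e1 : z.im ^ 2 * (((2 * A * z.re + B) / z.im) ^ 2 + (2 * A - T / z.im) ^ 2) = T ^ 2 - 1 := by
    field_simp
    linear_combination (-4 * A) * hTz - hd
  have e2 : z.im ^ 2 * (2 * A / z.im + (-(2 * A - T / z.im) / z.im + T / z.im ^ 2)) = 2 * T := by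
    field_simp
    ring
  linear_combination legendreQ n 2 T * e1 + legendreQ n 1 T * e2

/-! ### Raising functions of a quadratic height -/

/-- `2 i ∂/∂z` of `(A |z| ^ 2 + B x + C) / y`. -/
def quadRaise (A B C : ℝ) (z : ℂ) : ℂ :=
  -((A * starRingEnd ℂ z ^ 2 + B * starRingEnd ℂ z + C) * ((z.im : ℂ)⁻¹) ^ 2)

theorem wirtingerCLM_apply (L : ℂ →L[ℝ] ℂ) :
    wirtingerCLM L = Complex.I * L 1 + L Complex.I := by
  simp only [wirtingerCLM]
  simp
  ring_nf
  simp

theorem hasFDerivAt_im_inv {z : ℂ} (hz : 0 < z.im) :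
    HasFDerivAt (fun y : ℂ => y.im⁻¹) ((-(z.im ^ 2)⁻¹) • Complex.imCLM) z :=
  (hasDerivAt_inv hz.ne').comp_hasFDerivAt z Complex.imCLM.hasFDerivAt

theorem hasFDerivAt_quadHeight (A B C : ℝ) {z : ℂ} (hz : 0 < z.im) :
    ∃ L : ℂ →L[ℝ] ℝ, HasFDerivAt (quadHeight A B C) L z ∧
      wirtingerCLM (Complex.ofRealCLM.comp L) = quadRaise A B C z := by
  have hre : HasFDerivAt Complex.re Complex.reCLM z := Complex.reCLM.hasFDerivAt
  have him : HasFDerivAt Complex.im Complex.imCLM z := Complex.imCLM.hasFDerivAt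
  have h := (((((hre.pow 2).add (him.pow 2)).const_mul A).add (hre.const_mul B)).add_const C).mul
    (hasFDerivAt_im_inv hz)
  refine ⟨_, h.congr_of_eventuallyEq (Eventually.of_forall fun y => ?_), ?_⟩
  · simp [quadHeight, div_eq_mul_inv]
  · have hz' : (z.im : ℂ) ≠ 0 := by exact_mod_cast hz.ne'
    have hc : starRingEnd ℂ z = z.re - z.im * Complex.I := by
      apply Complex.ext <;> simp
    rw [wirtingerCLM_apply, quadRaise, hc]
    simp
    field_simp
    ring_nf
    simp only [Complex.I_sq]
    ring

/-- The polynomial in the conjugate of z is killed by ∂/∂z, so only y⁻² contributes. The result says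
that R_2 annihilates `quadRaise`. -/
theorem hasFDerivAt_quadRaise (A B C : ℝ) {z : ℂ} (hz : 0 < z.im) :
    ∃ L : ℂ →L[ℝ] ℂ, HasFDerivAt (quadRaise A B C) L z ∧
      wirtingerCLM L = -(2 * (z.im : ℂ)⁻¹ * quadRaise A B C z) := by
  have hconj : HasFDerivAt (fun y : ℂ => starRingEnd ℂ y) (Complex.conjCLE : ℂ →L[ℝ] ℂ) z :=
    Complex.conjCLE.hasFDerivAt
  have him : HasFDerivAt (fun y : ℂ => ((y.im : ℂ)⁻¹))
      (Complex.ofRealCLM.comp ((-(z.im ^ 2)⁻¹) • Complex.imCLM)) z := by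
    have := (Complex.ofRealCLM.hasFDerivAt (x := z.im⁻¹)).comp z (hasFDerivAt_im_inv hz)
    refine this.congr_of_eventuallyEq (Eventually.of_forall fun y => ?_)
    simp
  have h := (((((hconj.pow 2).const_mul (A : ℂ)).add (hconj.const_mul (B : ℂ))).add_const
    (C : ℂ)).mul (him.pow 2)).neg
  refine ⟨_, h.congr_of_eventuallyEq (Eventually.of_forall fun y => ?_), ?_⟩
  · simp [quadRaise]
  · have hz' : (z.im : ℂ) ≠ 0 := by exact_mod_cast hz.ne'
    rw [wirtingerCLM_apply, quadRaise]
    simp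
    field_simp
    ring_nf

/-- The weight term 2n/y of R_{2n} cancels the derivative of the n-th power of `quadRaise`; each
step therefore only differentiates the Legendre function and adds one factor. -/
theorem raiseIter_legendreQ_quadHeight (m : ℕ) {A B C : ℝ} (n : ℕ) :
    Set.EqOn (raiseIter 0 n fun y => ((legendreQ m 0 (quadHeight A B C y) : ℝ) : ℂ))
      (fun z => (legendreQ m n (quadHeight A B C z) : ℂ) * quadRaise A B C z ^ n)
      {z | 0 < z.im ∧ 1 < quadHeight A B C z} := by
  have hopen := isOpen_quadHeight A B C
  induction n with
  | zero => intro z _; simp [raiseIter]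
  | succ n ih =>
    intro z hz
    simp only [raiseIter]
    rw [raise_congr (ih.eventuallyEq_of_mem (hopen.mem_nhds hz)), raise_eq]
    obtain ⟨L, hL, hLw⟩ := hasFDerivAt_quadHeight A B C hz.1
    obtain ⟨L', hL', hLw'⟩ := hasFDerivAt_quadRaise A B C hz.1
    have h1 := (Complex.ofRealCLM.hasFDerivAt (x := legendreQ m n (quadHeight A B C z))).comp z
      ((hasDerivAt_legendreQ m n hz.2).comp_hasFDerivAt z hL)
    have h2 := h1.mul (hL'.pow n)
    have h3 : HasFDerivAt (fun z => (legendreQ m n (quadHeight A B C z) : ℂ) *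
      quadRaise A B C z ^ n) _ z := h2
    rw [h3.fderiv]
    rw [wirtingerCLM_apply] at hLw hLw' ⊢
    have hz' : (z.im : ℂ) ≠ 0 := by exact_mod_cast hz.1.ne'
    simp at hLw hLw' ⊢
    rcases n with _ | n
    · simp
      linear_combination (legendreQ m 1 (quadHeight A B C z) : ℂ) * hLw
    · simp only [Nat.add_sub_cancel]
      push_cast
      linear_combination (legendreQ m (n + 1 + 1) (quadHeight A B C z) : ℂ) *
          quadRaise A B C z ^ (n + 1) * hLw +
        (legendreQ m (n + 1) (quadHeight A B C z) : ℂ) * (n + 1) * quadRaise A B C z ^ n * hLw'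

/-! ### The higher Green's function as a Poincaré series -/

theorem OrbitEquiv.symm {z w : ℍ} (h : OrbitEquiv z w) : OrbitEquiv w z := by
  obtain ⟨γ, rfl⟩ := h
  exact ⟨γ⁻¹, inv_smul_smul γ w⟩

theorem orbitEquiv_smul_left {z w : ℍ} (γ : SL(2, ℤ)) : OrbitEquiv (γ • z) w ↔ OrbitEquiv z w := by
  constructor
  · rintro ⟨γ', h⟩
    exact ⟨γ⁻¹ * γ', by rw [mul_smul, h, inv_smul_smul]⟩
  · rintro ⟨γ', rfl⟩
    exact ⟨γ * γ', mul_smul _ _ _⟩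

theorem one_lt_cosh_dist {z w : ℍ} (h : z ≠ w) : 1 < Real.cosh (dist z w) :=
  Real.one_lt_cosh.2 (dist_ne_zero.2 h)

/-- Coercivity holds for every pair of points of ℍ, so only the condition cosh d > 1 matters.
Openness of the inequivalence locus follows from that of the coercive set. -/
theorem heightTensor_mem_coerciveSet_iff (z w : ℍ) :
    heightTensor z w ∈ coerciveSet modularLinearForm entryNorm ↔ ¬ OrbitEquiv z w := by
  constructor
  · rintro ⟨h, -⟩ ⟨γ, rfl⟩
    have := h γ⁻¹
    rw [modularLinearForm_heightTensor, inv_smul_smul, dist_self, Real.cosh_zero] at this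
    exact lt_irrefl _ this
  · intro h
    refine ⟨fun γ => ?_, ?_⟩
    · rw [modularLinearForm_heightTensor]
      refine one_lt_cosh_dist fun e => h ⟨γ⁻¹, ?_⟩
      rw [← e, inv_smul_smul]
    · obtain ⟨κ, hκ, hb⟩ := exists_entryNorm_le_cosh_dist_smul z w
      exact ⟨κ, hκ, fun γ => by rw [modularLinearForm_heightTensor]; exact hb γ⟩

theorem contDiffOn_heightTensor :
    ContDiffOn ℝ ∞ (fun p : ℂ × ℂ => heightTensor p.1 p.2) {p | 0 < p.1.im ∧ 0 < p.2.im} := by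
  refine contDiffOn_pi.2 fun i => contDiffOn_pi.2 fun j => ?_
  have h := contDiffOn_pi.1 contDiffOn_heightVec
  exact ((h i).comp contDiff_fst.contDiffOn fun p hp => hp.1).mul
    ((h j).comp contDiff_snd.contDiffOn fun p hp => hp.2)

/-- The pairs of points of the upper half-plane that are inequivalent under `SL₂(ℤ)`. -/
def inequivSet : Set (ℂ × ℂ) :=
  {p : ℂ × ℂ | 0 < p.1.im ∧ 0 < p.2.im ∧ ¬ OrbitEquiv (ofComplex p.1) (ofComplex p.2)}

theorem mem_inequivSet_iff (p : ℂ × ℂ) : p ∈ inequivSet ↔ p ∈ {p : ℂ × ℂ | 0 < p.1.im ∧ 0 < p.2.im} ∩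
    (fun p : ℂ × ℂ => heightTensor p.1 p.2) ⁻¹' coerciveSet modularLinearForm entryNorm := by
  simp only [inequivSet, Set.mem_ofPred, Set.mem_inter_iff, Set.mem_preimage, and_assoc]
  refine and_congr_right fun h1 => and_congr_right fun h2 => ?_
  rw [ofComplex_apply_of_im_pos h1, ofComplex_apply_of_im_pos h2,
    ← heightTensor_mem_coerciveSet_iff]

theorem isOpen_modularCoerciveSet : IsOpen (coerciveSet modularLinearForm entryNorm) :=
  isOpen_coerciveSet (M := 9) (by norm_num) entryNorm_pos norm_modularLinearForm_le
    (summable_entryNorm le_rfl)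

theorem isOpen_inequivSet : IsOpen inequivSet := by
  rw [Set.ext mem_inequivSet_iff]
  refine contDiffOn_heightTensor.continuousOn.isOpen_inter_preimage ?_ isOpen_modularCoerciveSet
  exact (isOpen_lt continuous_const (Complex.continuous_im.comp continuous_fst)).inter
    (isOpen_lt continuous_const (Complex.continuous_im.comp continuous_snd))

theorem summableSmoothOn_modular {n : ℕ} (hn : 1 ≤ n) :
    SummableSmoothOn (fun γ (p : ℂ × ℂ) => legendreQ n 0 (modularLinearForm γ (heightTensor p.1 p.2)))
      inequivSet :=
  (summableSmoothOn_legendreQ (M := 9) (by norm_num) entryNorm_pos norm_modularLinearForm_le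
    (summable_entryNorm hn)).comp isOpen_inequivSet isOpen_modularCoerciveSet
    (contDiffOn_heightTensor.mono fun p hp => ((mem_inequivSet_iff p).1 hp).1)
    fun p hp => ((mem_inequivSet_iff p).1 hp).2

/-- The points of the upper half-plane that are not equivalent to `w`. -/
def inequivSlice (w : ℍ) : Set ℂ := {z : ℂ | 0 < z.im ∧ ¬ OrbitEquiv (ofComplex z) w}

theorem mem_inequivSlice_iff (w : ℍ) (z : ℂ) : z ∈ inequivSlice w ↔ (z, (w : ℂ)) ∈ inequivSet := by
  simp [inequivSlice, inequivSet, ofComplex_apply, w.im_pos]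

theorem isOpen_inequivSlice (w : ℍ) : IsOpen (inequivSlice w) := by
  rw [Set.ext (mem_inequivSlice_iff w)]
  exact isOpen_inequivSet.preimage (by fun_prop : Continuous fun z : ℂ => (z, (w : ℂ)))

theorem coe_mem_inequivSlice {z w : ℍ} (h : ¬ OrbitEquiv z w) : (z : ℂ) ∈ inequivSlice w :=
  ⟨z.im_pos, by rwa [ofComplex_apply]⟩

theorem summableSmoothOn_slice {n : ℕ} (hn : 1 ≤ n) (w : ℍ) :
    SummableSmoothOn (fun γ (z : ℂ) => legendreQ n 0 (modularLinearForm γ (heightTensor z w)))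
      (inequivSlice w) :=
  (summableSmoothOn_modular hn).comp (c := fun z : ℂ => (z, (w : ℂ))) (isOpen_inequivSlice w)
    isOpen_inequivSet (by fun_prop) fun z hz => (mem_inequivSlice_iff w z).1 hz

/-- The Poincaré series `-∑ Q_n (cosh dist (γ z) w)` over `SL₂(ℤ)`. -/
def greenSeries (n : ℕ) (z w : ℍ) : ℝ :=
  -∑' γ : SL(2, ℤ), legendreQ n 0 (Real.cosh (dist (γ • z) w))

theorem greenSeries_ofComplex (n : ℕ) {z w : ℂ} (hz : 0 < z.im) (hw : 0 < w.im) :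
    greenSeries n (ofComplex z) (ofComplex w) =
      -∑' γ, legendreQ n 0 (modularLinearForm γ (heightTensor z w)) := by
  rw [ofComplex_apply_of_im_pos hz, ofComplex_apply_of_im_pos hw, greenSeries]
  simp only [← modularLinearForm_heightTensor]

theorem greenSeries_slice (n : ℕ) {z : ℂ} (w : ℍ) (hz : 0 < z.im) :
    greenSeries n (ofComplex z) w =
      -∑' γ, legendreQ n 0 (modularLinearForm γ (heightTensor z w)) := by
  rw [← greenSeries_ofComplex n hz w.im_pos]
  simp [ofComplex_apply]

theorem greenSeries_smul_smul (n : ℕ) (γ₁ γ₂ : SL(2, ℤ)) (z w : ℍ) :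
    greenSeries n (γ₁ • z) (γ₂ • w) = greenSeries n z w := by
  -- Reindexing by γ ↦ γ₂⁻¹ γ γ₁.
  rw [greenSeries, greenSeries, ← ((Equiv.mulRight γ₁).trans (Equiv.mulLeft γ₂⁻¹)).tsum_eq
    fun γ => legendreQ n 0 (Real.cosh (dist (γ • z) w))]
  congr 2
  ext γ
  congr 2
  rw [← dist_smul_modular γ₂⁻¹, inv_smul_smul]
  simp [mul_smul]

theorem greenSeries_comm (n : ℕ) (z w : ℍ) : greenSeries n z w = greenSeries n w z := by
  rw [greenSeries, greenSeries, ← (Equiv.inv SL(2, ℤ)).tsum_eq]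
  congr 2
  ext γ
  congr 2
  rw [← dist_smul_modular γ, dist_comm]
  simp

theorem contDiffOn_greenSeries {n : ℕ} (hn : 1 ≤ n) :
    ContDiffOn ℝ ∞ (fun p : ℂ × ℂ => greenSeries n (ofComplex p.1) (ofComplex p.2)) inequivSet :=
  ((summableSmoothOn_modular hn).contDiffOn_tsum isOpen_inequivSet).neg.congr fun _ hp =>
    greenSeries_ofComplex n hp.1 hp.2.1

theorem exists_modularLinearForm_eq_quadHeight (γ : SL(2, ℤ)) (w : ℍ) :
    ∃ A B C : ℝ, 4 * A * C - B ^ 2 = 1 ∧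
      ∀ z : ℂ, modularLinearForm γ (heightTensor z w) = quadHeight A B C z := by
  have hw := w.im_ne_zero
  refine ⟨∑ j, modularCoeff γ 0 j * heightVec w j, ∑ j, modularCoeff γ 1 j * heightVec w j,
    ∑ j, modularCoeff γ 2 j * heightVec w j, ?_, fun z => ?_⟩
  · simp [Fin.sum_univ_three, modularCoeff, heightVec]
    have hd := det_eq_one γ
    field_simp
    linear_combination 4 * w.im ^ 2 * ((γ 0 0 * γ 1 1 - γ 0 1 * γ 1 0 : ℝ) + 1) * hd
  · rw [modularLinearForm_apply]
    simp [Fin.sum_univ_three, heightTensor, heightVec, quadHeight]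
    ring

theorem one_lt_modularLinearForm {w : ℍ} {z : ℂ} (hz : z ∈ inequivSlice w) (γ : SL(2, ℤ)) :
    1 < modularLinearForm γ (heightTensor z w) :=
  ((mem_inequivSet_iff _).1 ((mem_inequivSlice_iff w z).1 hz)).2.1 γ

theorem hypLaplacian_greenSeries {n : ℕ} (hn : 1 ≤ n) {z w : ℍ} (h : ¬ OrbitEquiv z w) :
    hypLaplacian (fun u => greenSeries n u w) z = -(n * (n + 1)) * greenSeries n z w := by
  have hz := coe_mem_inequivSlice h
  have hopen := isOpen_inequivSlice w
  have he : (fun u : ℂ => greenSeries n (ofComplex u) w) =ᶠ[𝓝 (z : ℂ)]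
      -fun u => ∑' γ, legendreQ n 0 (modularLinearForm γ (heightTensor u w)) := by
    filter_upwards [hopen.mem_nhds hz] with u hu using greenSeries_slice n w hu.1
  have hs := summableSmoothOn_slice hn w
  rw [hypLaplacian, InnerProductSpace.laplacian_congr_nhds he |>.eq_of_nhds,
    InnerProductSpace.laplacian_neg, Pi.neg_apply, laplacian_tsum hopen hs hz]
  have h2 := greenSeries_slice n w z.im_pos
  rw [ofComplex_apply] at h2
  rw [h2, neg_mul_neg, neg_mul_neg, ← tsum_mul_left, ← tsum_mul_left]
  congr 1
  ext γ
  obtain ⟨A, B, C, hd, hq⟩ := exists_modularLinearForm_eq_quadHeight γ w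
  have h1 := one_lt_modularLinearForm hz γ
  simp only [hq] at h1 ⊢
  exact laplacian_legendreQ_quadHeight n hd z.im_pos h1

/-! ### Stabilizers -/

theorem mem_center_modular (γ : SL(2, ℤ)) :
    γ ∈ Subgroup.center SL(2, ℤ) ↔ γ = 1 ∨ γ = -1 := by
  rw [Matrix.SpecialLinearGroup.mem_center_iff]
  constructor
  · rintro ⟨r, hr, h⟩
    rw [Fintype.card_fin] at hr
    rcases mul_self_eq_one_iff.1 (by rw [← sq]; exact hr : r * r = 1) with rfl | rfl
    · left
      ext i j
      rw [← h]
      fin_cases i <;> fin_cases j <;> simp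
    · right
      ext i j
      rw [← h]
      fin_cases i <;> fin_cases j <;> simp
  · rintro (rfl | rfl)
    · exact ⟨1, by simp, by simp⟩
    · exact ⟨-1, by simp, by ext i j; fin_cases i <;> fin_cases j <;> simp⟩

/-- The projection to PSL₂(ℤ), restricted to the stabilizer, has kernel {1, -1}, since -1 acts
trivially. -/
theorem card_stabilizer (w : ℍ) :
    Nat.card (MulAction.stabilizer SL(2, ℤ) w) = 2 * omega w := by
  set S := MulAction.stabilizer SL(2, ℤ) w
  set f := (QuotientGroup.mk' (Subgroup.center SL(2, ℤ))).subgroupMap S with hf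
  have hsurj : Function.Surjective f := MonoidHom.subgroupMap_surjective _ _
  have h1 := Subgroup.card_eq_card_quotient_mul_card_subgroup f.ker
  rw [Nat.card_congr (QuotientGroup.quotientKerEquivOfSurjective f hsurj).toEquiv] at h1
  have hne : (1 : SL(2, ℤ)) ≠ -1 := by
    intro h
    have := congrArg (fun γ : SL(2, ℤ) => γ 0 0) h
    simp at this
  have h2 : Nat.card f.ker = 2 := by
    have hmem : ∀ γ : S, γ ∈ f.ker ↔ (γ : SL(2, ℤ)) = 1 ∨ (γ : SL(2, ℤ)) = -1 := by
      intro γ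
      rw [MonoidHom.mem_ker, ← mem_center_modular, hf, ← Subtype.coe_inj]
      simp
    have hneg : (-1 : SL(2, ℤ)) ∈ S := by
      rw [MulAction.mem_stabilizer_iff, ModularGroup.SL_neg_smul, one_smul]
    rw [Nat.card_eq_two_iff]
    refine ⟨⟨1, one_mem _⟩, ⟨⟨-1, hneg⟩, (hmem _).2 (Or.inr rfl)⟩, ?_, ?_⟩
    · intro h
      exact hne (congrArg (fun x : f.ker => ((x : S) : SL(2, ℤ))) h)
    · ext ⟨x, hx⟩
      rcases (hmem x).1 hx with h | h
      · have : x = 1 := Subtype.ext h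
        simp [this]
      · have : x = ⟨-1, hneg⟩ := Subtype.ext h
        simp [this]
  rw [h1, h2, mul_comm]
  rfl

/-- On the stabilizer cosh d = 1, so the entry norm is at most 1/κ, which only finitely many
matrices satisfy. -/
theorem finite_stabilizer (w : ℍ) :
    (MulAction.stabilizer SL(2, ℤ) w : Set SL(2, ℤ)).Finite := by
  obtain ⟨κ, hκ, h⟩ := exists_entryNorm_le_cosh_dist_smul w w
  refine (Filter.eventually_cofinite.1
    (eventually_cofinite_le entryNorm_pos (summable_entryNorm le_rfl) (2 / κ))).subset ?_
  intro γ hγ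
  have h1 : γ • w = w := hγ
  have h2 := h γ
  rw [h1, dist_self, Real.cosh_zero] at h2
  simp only [Set.mem_ofPred, not_le]
  rw [lt_div_iff₀ hκ]
  linarith

/-! ### Behaviour at the singularity and at the cusp -/

/-- It rests on (cosh d + 1)/(cosh d - 1) = r⁻², so the right side is -Q_0(cosh d). -/
theorem log_rDist {z w : ℍ} (h : z ≠ w) :
    Real.log (rDist w z) = -(1 / 2 * Real.log ((Real.cosh (dist z w) + 1) /
      (Real.cosh (dist z w) - 1))) := by
  have h1 := one_lt_cosh_dist h
  have hz := z.im_pos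
  have hw := w.im_pos
  have hne : (z : ℂ) - w ≠ 0 := sub_ne_zero.2 fun e => h (UpperHalfPlane.ext e)
  have hp : 0 < Complex.normSq ((z : ℂ) - w) := Complex.normSq_pos.2 hne
  have hb : Complex.normSq ((z : ℂ) - starRingEnd ℂ (w : ℂ)) =
      Complex.normSq ((z : ℂ) - w) + 4 * z.im * w.im := by
    simp only [Complex.normSq_apply]
    simp
    ring
  have h2 : (Real.cosh (dist z w) + 1) / (Real.cosh (dist z w) - 1) = (rDist w z ^ 2)⁻¹ := by
    rw [rDist, norm_div, div_pow, ← Complex.normSq_eq_norm_sq, ← Complex.normSq_eq_norm_sq, hb,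
      cosh_dist, Complex.dist_eq, ← Complex.normSq_eq_norm_sq]
    generalize Complex.normSq ((z : ℂ) - w) = N at hp ⊢
    rw [add_sub_cancel_left]
    field_simp
    ring
  rw [h2, Real.log_inv, Real.log_pow]
  push_cast
  ring

theorem abs_legendreQ_add_log_rDist_le (n : ℕ) {z w : ℍ} (h : z ≠ w) :
    |legendreQ n 0 (Real.cosh (dist z w)) + Real.log (rDist w z)| ≤ n := by
  rw [log_rDist h, ← sub_eq_add_neg]
  exact abs_legendreQ_sub_log_le n (one_lt_cosh_dist h)

theorem continuous_heightTensor_left (w : ℍ) : Continuous fun z : ℍ => heightTensor z w := by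
  have h : ContinuousOn (fun p : ℂ × ℂ => heightTensor p.1 p.2) {p | 0 < p.1.im ∧ 0 < p.2.im} :=
    contDiffOn_heightTensor.continuousOn
  exact h.comp_continuous (continuous_coe.prodMk continuous_const)
    fun z => ⟨z.im_pos, w.im_pos⟩

/-- The 2ω stabilizer terms all equal Q_n(cosh d(z, w)) = -log r + O(1). The remaining family is
coercive at (w, w) itself, so its sum is bounded near w. -/
theorem greenSeries_singularity {n : ℕ} (hn : 1 ≤ n) (w : ℍ) :
    (fun z => greenSeries n z w - 2 * omega w * Real.log (rDist w z)) =O[𝓝[≠] w]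
      (fun _ => (1 : ℝ)) := by
  classical
  set S := (finite_stabilizer w).toFinset with hS
  have hmemS : ∀ γ, γ ∈ S ↔ γ • w = w := fun γ => by
    rw [hS, Set.Finite.mem_toFinset]; rfl
  have hcard : (S.card : ℝ) = 2 * omega w := by
    rw [hS, ← Nat.card_eq_card_finite_toFinset]
    exact_mod_cast card_stabilizer w
  set ℓ : {γ // γ ∉ S} → (Fin 3 → Fin 3 → ℝ) →L[ℝ] ℝ := fun γ => modularLinearForm γ
  set r : {γ // γ ∉ S} → ℝ := fun γ => entryNorm γ
  have hsm : SummableSmoothOn (fun γ x => legendreQ n 0 (ℓ γ x)) (coerciveSet ℓ r) :=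
    summableSmoothOn_legendreQ (M := 9) (by norm_num) (fun γ => entryNorm_pos γ)
      (fun γ => norm_modularLinearForm_le γ) ((summable_entryNorm hn).subtype _)
  have hopen : IsOpen (coerciveSet ℓ r) :=
    isOpen_coerciveSet (M := 9) (by norm_num) (fun γ => entryNorm_pos γ)
      (fun γ => norm_modularLinearForm_le γ) ((summable_entryNorm hn).subtype _)
  have hmem : heightTensor w w ∈ coerciveSet ℓ r := by
    refine ⟨fun γ => ?_, ?_⟩
    · change 1 < modularLinearForm γ _
      rw [modularLinearForm_heightTensor]
      exact one_lt_cosh_dist fun e => γ.2 ((hmemS _).2 e)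
    · obtain ⟨κ, hκ, hb⟩ := exists_entryNorm_le_cosh_dist_smul w w
      exact ⟨κ, hκ, fun γ => by
        change _ ≤ modularLinearForm γ _
        rw [modularLinearForm_heightTensor]; exact hb γ⟩
  obtain ⟨u, hu, hb⟩ := hsm.bound _ hmem 0
  have hc : Tendsto (fun z : ℍ => heightTensor z w) (𝓝[≠] w) (𝓝 (heightTensor w w)) :=
    ((continuous_heightTensor_left w).tendsto w).mono_left nhdsWithin_le_nhds
  refine Asymptotics.IsBigO.of_bound (2 * omega w * n + ∑' i, u i) ?_
  filter_upwards [hc.eventually hb, hc.eventually (hopen.mem_nhds hmem),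
    self_mem_nhdsWithin] with z hz hzU hzw
  have hzw : z ≠ w := hzw
  simp only [norm_iteratedFDeriv_zero] at hz
  set F : SL(2, ℤ) → ℝ := fun γ => legendreQ n 0 (Real.cosh (dist (γ • z) w)) with hF
  have hFt : ∀ γ : {γ // γ ∉ S}, F γ = legendreQ n 0 (ℓ γ (heightTensor z w)) := fun γ => by
    rw [hF]
    change _ = legendreQ n 0 (modularLinearForm γ _)
    rw [modularLinearForm_heightTensor]
  have hsub : Summable fun γ : {γ // γ ∉ S} => F γ :=
    hu.of_norm_bounded fun γ => by rw [hFt]; exact hz γ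
  have hsum : Summable F := by
    have := (Finset.summable_compl_iff S (f := F)).1 hsub
    exact this
  have hFS : ∀ γ ∈ S, F γ = legendreQ n 0 (Real.cosh (dist z w)) := fun γ hγ => by
    have h1 := dist_smul_modular γ z w
    rw [(hmemS γ).1 hγ] at h1
    simp only [hF, h1]
  have hsplit := hsum.sum_add_tsum_subtype_compl S
  rw [Finset.sum_congr rfl hFS, Finset.sum_const, nsmul_eq_mul, hcard] at hsplit
  have htail : |∑' γ : {γ // γ ∉ S}, F γ| ≤ ∑' i, u i := by
    have := tsum_of_norm_bounded hu.hasSum fun γ : {γ // γ ∉ S} => by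
      have := hz γ
      rwa [← hFt] at this
    simpa [Real.norm_eq_abs] using this
  have hQ := abs_legendreQ_add_log_rDist_le n hzw
  have e : greenSeries n z w - 2 * omega w * Real.log (rDist w z) =
      -(2 * omega w * (legendreQ n 0 (Real.cosh (dist z w)) + Real.log (rDist w z))) -
        ∑' γ : {γ // γ ∉ S}, F γ := by
    rw [greenSeries, ← hsplit]
    ring
  rw [e, norm_one, mul_one, Real.norm_eq_abs]
  refine (abs_sub _ _).trans (add_le_add ?_ htail)
  rw [abs_neg, abs_mul, abs_of_nonneg (by positivity : (0 : ℝ) ≤ 2 * omega w)]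
  gcongr

theorem tendsto_legendreQ (n : ℕ) : Tendsto (legendreQ n 0) atTop (𝓝 0) := by
  have := (tendsto_legendreInt n n).const_mul
    ((-1) ^ 0 * ((n + 1).ascFactorial 0 : ℝ) / 2 ^ (n + 1))
  rw [mul_zero] at this
  exact this

/-- The translate of `z` by an integer whose real part is at most `1 / 2` in absolute value. -/
def stripTranslate (z : ℍ) : ℍ := ModularGroup.T ^ (-round z.re) • z

theorem stripTranslate_im (z : ℍ) : (stripTranslate z).im = z.im := by
  rw [stripTranslate, modular_T_zpow_smul, vadd_im]

theorem abs_stripTranslate_re_le (z : ℍ) : |(stripTranslate z).re| ≤ 1 / 2 := by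
  rw [stripTranslate, modular_T_zpow_smul, vadd_re]
  have := abs_sub_round z.re
  push_cast
  rwa [neg_add_eq_sub]

/-- An integer translation moves z into |x| ≤ 1/2 at the same height. There each term tends to 0,
because cosh d ≥ κy, under the summable majorant, so dominated convergence applies. -/
theorem tendsto_greenSeries_atImInfty {n : ℕ} (hn : 1 ≤ n) (w : ℍ) :
    Tendsto (fun z => greenSeries n z w) atImInfty (𝓝 0) := by
  obtain ⟨κ, hκ, hb⟩ := exists_le_cosh_dist_smul w
  obtain ⟨C, hC, hQ⟩ := abs_legendreQ_le n 0
  have him : Tendsto UpperHalfPlane.im atImInfty atTop := tendsto_comap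
  have hlow : ∀ z : ℍ, 1 ≤ z.im → ∀ γ : SL(2, ℤ),
      κ * z.im ≤ Real.cosh (dist (γ • stripTranslate z) w) ∧
      κ * ((γ 0 0 ^ 2 + γ 1 0 ^ 2 : ℝ) * (1 + |((modularIndex γ).2 : ℝ)|) / 4) ≤
        Real.cosh (dist (γ • stripTranslate z) w) := by
    intro z hz γ
    have h1 := hb γ (stripTranslate z)
    have h2 := modularIndex_bound γ (abs_stripTranslate_re_le z)
      (y := (stripTranslate z).im) (by rwa [stripTranslate_im])
    refine ⟨le_trans ?_ h1, le_trans ?_ h1⟩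
    · rw [stripTranslate_im]
      gcongr
      have hR : (1 : ℝ) ≤ γ 0 0 ^ 2 + γ 1 0 ^ 2 := by exact_mod_cast one_le_column γ
      rw [le_div_iff₀ (by linarith)]
      nlinarith [sq_nonneg (γ 0 0 * (stripTranslate z).re + γ 0 1),
        sq_nonneg (γ 1 0 * (stripTranslate z).re + γ 1 1), sq_nonneg z.im]
    · gcongr
  have key : Tendsto (fun z => ∑' γ : SL(2, ℤ),
      legendreQ n 0 (Real.cosh (dist (γ • stripTranslate z) w))) atImInfty
      (𝓝 (∑' _ : SL(2, ℤ), 0)) := by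
    refine tendsto_tsum_of_dominated_convergence
      (bound := fun γ => C * (4 / κ) ^ (n + 1) * modularMajorant n γ)
      ((summable_modularMajorant hn).mul_left _) (fun γ => ?_) ?_
    · refine (tendsto_legendreQ n).comp (tendsto_atTop_mono' _ ?_ (him.const_mul_atTop hκ))
      filter_upwards [him.eventually_ge_atTop 1] with z hz using (hlow z hz γ).1
    · filter_upwards [him.eventually_ge_atTop 1, him.eventually_ge_atTop (2 / κ)] with z hz hz2 γ
      have h := hlow z hz γ
      have hpos : 0 < κ * ((γ 0 0 ^ 2 + γ 1 0 ^ 2 : ℝ) * (1 + |((modularIndex γ).2 : ℝ)|) / 4) := by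
        have := column_pos γ
        positivity
      have h2 : 2 ≤ Real.cosh (dist (γ • stripTranslate z) w) := by
        refine le_trans ?_ h.1
        rwa [div_le_iff₀' hκ] at hz2
      refine (hQ _ h2).trans ?_
      have e : C * (4 / κ) ^ (n + 1) * modularMajorant n γ =
          C * ((κ * ((γ 0 0 ^ 2 + γ 1 0 ^ 2 : ℝ) * (1 + |((modularIndex γ).2 : ℝ)|) / 4))⁻¹) ^
            (n + 1) := by
        rw [modularMajorant, mul_assoc, ← mul_pow]
        congr 2
        have := (column_pos γ).ne'
        field_simp
      rw [e, add_zero]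
      gcongr
      exact h.2
  rw [tsum_zero] at key
  have h3 := key.neg
  rw [neg_zero] at h3
  refine h3.congr fun z => ?_
  have := greenSeries_smul_smul n (ModularGroup.T ^ (-round z.re)) 1 z w
  rw [one_smul] at this
  exact this

theorem isHigherGreen_greenSeries {n : ℕ} (hn : 1 ≤ n) : IsHigherGreen (n + 1) (greenSeries n) where
  smooth := contDiffOn_greenSeries hn
  invariant γ₁ γ₂ z w _ := greenSeries_smul_smul n γ₁ γ₂ z w
  laplacian_left z w h := by
    rw [hypLaplacian_greenSeries hn h]
    push_cast
    ring
  laplacian_right z w h := by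
    have e : (fun u => greenSeries n z u) = fun u => greenSeries n u z :=
      funext fun u => greenSeries_comm n z u
    rw [e, hypLaplacian_greenSeries hn fun h' => h h'.symm, greenSeries_comm n w z]
    push_cast
    ring
  singularity w := greenSeries_singularity hn w
  cusp w := tendsto_greenSeries_atImInfty hn w

/-! ### Uniqueness -/

theorem continuous_smul_modular (γ : SL(2, ℤ)) : Continuous fun z : ℍ => γ • z :=
  (Isometry.of_dist_eq (dist_smul_modular γ)).continuous

/-- The maximum principle on the modular curve, for functions that tend to `-∞` at `w`. -/
theorem nonpos_of_hypLaplacian_eq {w : ℍ} {H : ℍ → ℝ} {μ : ℝ} (hμ : 0 < μ)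
    (hsm : ContDiffOn ℝ 2 (fun u : ℂ => H (ofComplex u)) (inequivSlice w))
    (hinv : ∀ (γ : SL(2, ℤ)) (z : ℍ), ¬ OrbitEquiv z w → H (γ • z) = H z)
    (hlap : ∀ z, ¬ OrbitEquiv z w → hypLaplacian H z = -μ * H z)
    (hsing : Tendsto H (𝓝[≠] w) atBot) (hcusp : Tendsto H atImInfty (𝓝 0)) {z₀ : ℍ}
    (hz₀ : ¬ OrbitEquiv z₀ w) : H z₀ ≤ 0 := by
  classical
  by_contra! hpos
  set m := H z₀ with hm
  have hopenS : IsOpen {z : ℍ | ¬ OrbitEquiv z w} := by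
    convert (isOpen_inequivSlice w).preimage continuous_coe using 1
    ext z
    simp [inequivSlice, z.im_pos]
  have hcontH : ∀ z : ℍ, ¬ OrbitEquiv z w → ContinuousAt H z := fun z hz => by
    have h1 := (hsm.contDiffAt ((isOpen_inequivSlice w).mem_nhds
      (coe_mem_inequivSlice hz))).continuousAt
    have h2 := h1.comp (f := fun z : ℍ => (z : ℂ)) continuous_coe.continuousAt
    simpa [Function.comp_def, ofComplex_apply] using h2
  -- Cutting off below m/2 makes the function continuous across the orbit of w and constant high in
  -- the cusp, so its maximum is attained on a compact truncated fundamental domain.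
  set T : ℍ → ℝ := fun z => if OrbitEquiv z w then m / 2 else max (H z) (m / 2) with hT
  have hTinv : ∀ (γ : SL(2, ℤ)) (z : ℍ), T (γ • z) = T z := fun γ z => by
    by_cases h : OrbitEquiv z w
    · simp only [hT, orbitEquiv_smul_left, h, if_true]
    · simp only [hT, orbitEquiv_smul_left, h, if_false, hinv γ z h]
  have hTw : ∀ᶠ z in 𝓝 w, T z = m / 2 := by
    have h1 := hsing.eventually_lt_atBot (m / 2)
    rw [eventually_nhdsWithin_iff] at h1
    filter_upwards [h1] with z hz
    by_cases h : OrbitEquiv z w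
    · simp [hT, h]
    · have hne : z ≠ w := fun e => h ⟨1, by rw [e, one_smul]⟩
      simp only [hT, h, if_false]
      exact max_eq_right (hz hne).le
  have hTcont : Continuous T := continuous_iff_continuousAt.2 fun z => by
    by_cases h : OrbitEquiv z w
    · obtain ⟨γ, rfl⟩ := h
      have h2 : Tendsto (fun u : ℍ => γ⁻¹ • u) (𝓝 (γ • w)) (𝓝 w) := by
        have := (continuous_smul_modular γ⁻¹).tendsto (γ • w)
        rwa [inv_smul_smul] at this
      have h3 : T =ᶠ[𝓝 (γ • w)] fun _ => m / 2 := by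
        filter_upwards [h2.eventually hTw] with u hu
        rwa [hTinv] at hu
      exact continuousAt_const.congr h3.symm
    · have h3 : T =ᶠ[𝓝 z] fun u => max (H u) (m / 2) := by
        filter_upwards [hopenS.mem_nhds h] with u hu
        have hu : ¬ OrbitEquiv u w := hu
        simp [hT, hu]
      exact ContinuousAt.congr ((hcontH z h).max continuousAt_const) h3.symm
  obtain ⟨Y, hY⟩ := (atImInfty_mem _).1 (hcusp.eventually_lt_const (show 0 < m / 2 by linarith))
  have hTY : ∀ z : ℍ, Y ≤ z.im → T z = m / 2 := fun z hz => by
    have h1 : H z < m / 2 := hY z hz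
    by_cases h : OrbitEquiv z w
    · simp [hT, h]
    · simp only [hT, h, if_false]
      exact max_eq_right h1.le
  have hT0 : T z₀ = m := by
    simp only [hT, hz₀, if_false]
    exact max_eq_left (by linarith)
  obtain ⟨γ₀, hγ₀⟩ := ModularGroup.exists_smul_mem_fd z₀
  have hT0' : T (γ₀ • z₀) = m := by rw [hTinv, hT0]
  have hK0 : γ₀ • z₀ ∈ ModularGroup.truncatedFundamentalDomain Y := by
    refine ⟨hγ₀, ?_⟩
    by_contra! h
    have := hTY _ h.le
    linarith
  obtain ⟨z₁, hz₁K, hz₁⟩ := (ModularGroup.isCompact_truncatedFundamentalDomain Y).exists_isMaxOn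
    ⟨_, hK0⟩ hTcont.continuousOn
  have hT1 : m ≤ T z₁ := by
    have := hz₁ hK0
    rwa [Set.mem_ofPred, hT0'] at this
  have hglob : ∀ z, T z ≤ T z₁ := fun z => by
    obtain ⟨γ, hγ⟩ := ModularGroup.exists_smul_mem_fd z
    rw [← hTinv γ z]
    rcases le_total (γ • z).im Y with h | h
    · exact hz₁ (show γ • z ∈ ModularGroup.truncatedFundamentalDomain Y from ⟨hγ, h⟩)
    · rw [hTY _ h]
      linarith
  have hz₁w : ¬ OrbitEquiv z₁ w := fun h => by
    have : T z₁ = m / 2 := by simp [hT, h]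
    linarith
  have hH1 : H z₁ = T z₁ := by
    have h1 : T z₁ = max (H z₁) (m / 2) := by simp [hT, hz₁w]
    rcases max_choice (H z₁) (m / 2) with h | h
    · rw [h1, h]
    · rw [h] at h1; linarith
  have hmem := (isOpen_inequivSlice w).mem_nhds (coe_mem_inequivSlice hz₁w)
  have hlocmax : IsLocalMax (fun u : ℂ => H (ofComplex u)) (z₁ : ℂ) := by
    filter_upwards [hmem] with u hu
    rw [ofComplex_apply, hH1]
    refine le_trans ?_ (hglob (ofComplex u))
    simp [hT, hu.2]
  have hC2 := hsm.contDiffAt hmem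
  have hle : Laplacian.laplacian (fun u : ℂ => H (ofComplex u)) (z₁ : ℂ) ≤ 0 := by
    rw [laplacian_eq_fderiv_fderiv]
    exact add_nonpos (fderiv_fderiv_apply_nonpos_of_isLocalMax _ hC2 hlocmax)
      (fderiv_fderiv_apply_nonpos_of_isLocalMax _ hC2 hlocmax)
  have h2 := hlap z₁ hz₁w
  rw [hypLaplacian] at h2
  have h3 : 0 < H z₁ := by linarith
  -- At the maximum y²ΔH = μH > 0, while ΔH ≤ 0.
  nlinarith [mul_pos hμ h3, mul_nonneg (sq_nonneg z₁.im) (neg_nonneg.2 hle)]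

theorem tendsto_log_rDist (w : ℍ) : Tendsto (fun z => Real.log (rDist w z)) (𝓝[≠] w) atBot := by
  have hne : (w : ℂ) - starRingEnd ℂ (w : ℂ) ≠ 0 := by
    intro h
    have := congrArg Complex.im h
    simp at this
    linarith [w.im_pos]
  have hc : ContinuousAt (rDist w) w := by
    refine ContinuousAt.norm (ContinuousAt.div ?_ ?_ hne)
    · exact (continuous_coe.sub continuous_const).continuousAt
    · exact (continuous_coe.sub continuous_const).continuousAt
  have h0 : rDist w w = 0 := by simp [rDist]
  have h1 : Tendsto (rDist w) (𝓝[≠] w) (𝓝[≠] 0) := by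
    refine tendsto_nhdsWithin_of_tendsto_nhds_of_eventually_within _ ?_ ?_
    · rw [← h0]
      exact hc.tendsto.mono_left nhdsWithin_le_nhds
    · filter_upwards [self_mem_nhdsWithin] with z hz
      have hz : z ≠ w := hz
      have h1 : (z : ℂ) - w ≠ 0 := sub_ne_zero.2 fun e => hz (UpperHalfPlane.ext e)
      have h2 : (z : ℂ) - starRingEnd ℂ (w : ℂ) ≠ 0 := by
        intro h
        have := congrArg Complex.im h
        simp at this
        linarith [w.im_pos, z.im_pos]
      exact norm_ne_zero_iff.2 (div_ne_zero h1 h2)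
  exact Real.tendsto_log_nhdsNE_zero.comp h1

theorem omega_pos (w : ℍ) : 0 < omega w := by
  have h := card_stabilizer w
  have : Finite (MulAction.stabilizer SL(2, ℤ) w) := (finite_stabilizer w).to_subtype
  have := Nat.card_pos (α := MulAction.stabilizer SL(2, ℤ) w)
  omega

namespace IsHigherGreen

variable {k : ℕ} {G G' : ℍ → ℍ → ℝ}

theorem contDiffOn_slice (h : IsHigherGreen k G) (w : ℍ) :
    ContDiffOn ℝ ∞ (fun u : ℂ => G (ofComplex u) w) (inequivSlice w) := by
  have := h.smooth.comp (f := fun u : ℂ => (u, (w : ℂ))) (s := inequivSlice w)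
    (by fun_prop) fun u hu => (mem_inequivSlice_iff w u).1 hu
  simpa [Function.comp_def, ofComplex_apply] using this

theorem tendsto_atBot (h : IsHigherGreen k G) (w : ℍ) :
    Tendsto (fun z => G z w) (𝓝[≠] w) atBot := by
  obtain ⟨C, hC⟩ := (h.singularity w).bound
  have hω : (0 : ℝ) < 2 * omega w := by have := omega_pos w; positivity
  refine tendsto_atBot_mono' _ ?_ (tendsto_atBot_add_const_left _ C
    ((tendsto_log_rDist w).const_mul_atBot hω))
  filter_upwards [hC] with z hz
  rw [norm_one, mul_one, Real.norm_eq_abs, abs_le] at hz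
  linarith [hz.2]

/-- The difference G - G' is only known to be bounded near w. Adding εG', which tends to -∞ there,
brings it under the maximum principle. -/
theorem le_of_isHigherGreen (hk : 2 ≤ k) (h : IsHigherGreen k G) (h' : IsHigherGreen k G')
    {z w : ℍ} (hz : ¬ OrbitEquiv z w) : G z w ≤ G' z w := by
  have key : ∀ ε : ℝ, 0 < ε → G z w + (ε - 1) * G' z w ≤ 0 := by
    intro ε hε
    have hk' : (2 : ℝ) ≤ k := by exact_mod_cast hk
    have hsm := h.contDiffOn_slice w
    have hsm' := h'.contDiffOn_slice w
    refine nonpos_of_hypLaplacian_eq (w := w) (H := fun u => G u w + (ε - 1) * G' u w)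
      (μ := k * (k - 1)) (by nlinarith) ?_ (fun γ u hu => ?_) (fun u hu => ?_) ?_ ?_ hz
    · exact contDiffOn_infty.1 (hsm.add (contDiffOn_const.mul hsm')) 2
    · have e1 := h.invariant γ 1 u w hu
      have e2 := h'.invariant γ 1 u w hu
      rw [one_smul] at e1 e2
      simp only [e1, e2]
    · have hmem := (isOpen_inequivSlice w).mem_nhds (coe_mem_inequivSlice hu)
      have hc : ContDiffAt ℝ 2 (fun u : ℂ => G (ofComplex u) w) u :=
        contDiffAt_infty.1 (hsm.contDiffAt hmem) 2
      have hc' : ContDiffAt ℝ 2 (fun u : ℂ => G' (ofComplex u) w) u :=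
        contDiffAt_infty.1 (hsm'.contDiffAt hmem) 2
      have e1 := h.laplacian_left u w hu
      have e2 := h'.laplacian_left u w hu
      rw [hypLaplacian] at e1 e2 ⊢
      have e3 := hc.laplacian_add (f₂ := (ε - 1) • fun u : ℂ => G' (ofComplex u) w)
        (hc'.const_smul (ε - 1))
      rw [InnerProductSpace.laplacian_smul _ hc'] at e3
      have e4 : Laplacian.laplacian
          (fun u : ℂ => G (ofComplex u) w + (ε - 1) * G' (ofComplex u) w) (u : ℂ) =
          Laplacian.laplacian (fun u : ℂ => G (ofComplex u) w) u +
            (ε - 1) * Laplacian.laplacian (fun u : ℂ => G' (ofComplex u) w) u := e3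
      rw [e4]
      linear_combination e1 + (ε - 1) * e2
    · obtain ⟨C, hC⟩ := ((h.singularity w).sub (h'.singularity w)).bound
      refine tendsto_atBot_mono' _ ?_ (tendsto_atBot_add_const_left _ C
        ((h'.tendsto_atBot w).const_mul_atBot hε))
      filter_upwards [hC] with u hu
      rw [norm_one, mul_one, Real.norm_eq_abs, abs_le] at hu
      linarith [hu.2]
    · simpa using (h.cusp w).add ((h'.cusp w).const_mul (ε - 1))
  have ht : Tendsto (fun ε : ℝ => G z w + (ε - 1) * G' z w) (𝓝[>] 0)
      (𝓝 (G z w + (0 - 1) * G' z w)) := by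
    have : Continuous fun ε : ℝ => G z w + (ε - 1) * G' z w := by fun_prop
    exact (this.tendsto 0).mono_left nhdsWithin_le_nhds
  have := le_of_tendsto ht (eventually_nhdsWithin_of_forall key)
  linarith

theorem unique (hk : 2 ≤ k) (h : IsHigherGreen k G) (h' : IsHigherGreen k G')
    {z w : ℍ} (hz : ¬ OrbitEquiv z w) : G z w = G' z w :=
  le_antisymm (h.le_of_isHigherGreen hk h' hz) (h'.le_of_isHigherGreen hk h hz)

end IsHigherGreen

/-! ### Classes of binary quadratic forms -/

namespace BinForm

theorem comp_one (Q : BinForm) : Q.comp 1 = Q := by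
  ext <;> simp [comp]

theorem comp_comp (Q : BinForm) (γ₁ γ₂ : SL(2, ℤ)) : (Q.comp γ₁).comp γ₂ = Q.comp (γ₁ * γ₂) := by
  ext <;> simp [comp, Matrix.mul_apply, Fin.sum_univ_two] <;> ring

/-- This converts the sum over forms into the sum over hyperbolic distances. -/
theorem atPoint_comp_div_sqrt (Q : BinForm) (hQ : Q.PosDef) (γ : SL(2, ℤ)) (z : ℍ) :
    (Q.comp γ).atPoint z / √(Q.negDisc : ℝ) = Real.cosh (dist (γ • z) (Q.cmPoint hQ)) := by
  have ha : (0 : ℝ) < Q.a := by exact_mod_cast hQ.1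
  have hD : (0 : ℝ) < Q.negDisc := by exact_mod_cast hQ.2
  have hs := Real.sqrt_pos.2 hD
  have hs2 : √(Q.negDisc : ℝ) ^ 2 = 4 * Q.a * Q.c - Q.b ^ 2 := by
    rw [Real.sq_sqrt hD.le]; simp [negDisc]
  have hre : (Q.cmPoint hQ).re = -Q.b / (2 * Q.a) := rfl
  have him : (Q.cmPoint hQ).im = √(Q.negDisc : ℝ) / (2 * Q.a) := rfl
  have hz := z.im_pos
  have hn : ‖(z : ℂ)‖ ^ 2 = z.re ^ 2 + z.im ^ 2 := by
    rw [← Complex.normSq_eq_norm_sq, Complex.normSq_apply]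
    change z.re * z.re + z.im * z.im = _
    ring
  rw [cosh_dist_smul, hre, him, atPoint, hn]
  simp only [comp]
  push_cast
  generalize √(Q.negDisc : ℝ) = s at *
  field_simp
  linear_combination (-(γ 1 0 * z.re + γ 1 1) ^ 2 - γ 1 0 ^ 2 * z.im ^ 2 : ℝ) * hs2

theorem atPoint_div_sqrt (Q : BinForm) (hQ : Q.PosDef) (z : ℍ) :
    Q.atPoint z / √(Q.negDisc : ℝ) = Real.cosh (dist z (Q.cmPoint hQ)) := by
  have := atPoint_comp_div_sqrt Q hQ 1 z
  rwa [comp_one, one_smul] at this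

theorem eq_of_atPoint_eq {P Q : BinForm} (h : ∀ z : ℍ, P.atPoint z = Q.atPoint z) : P = Q := by
  have h1 := h ⟨⟨0, 1⟩, by norm_num⟩
  have h2 := h ⟨⟨0, 2⟩, by norm_num⟩
  have h3 := h ⟨⟨1, 1⟩, by norm_num⟩
  simp only [atPoint, ← Complex.normSq_eq_norm_sq, Complex.normSq_mk, UpperHalfPlane.im,
    UpperHalfPlane.re] at h1 h2 h3
  have ha : (P.a : ℝ) = Q.a := by linarith
  have hc : (P.c : ℝ) = Q.c := by linarith
  have hb : (P.b : ℝ) = Q.b := by linarith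
  ext
  · exact_mod_cast ha
  · exact_mod_cast hb
  · exact_mod_cast hc

/-- The distance function from τ_Q determines the form through its values at points, and the form's
value at τ_Q detects whether γ fixes it. -/
theorem comp_eq_self_iff (Q : BinForm) (hQ : Q.PosDef) (γ : SL(2, ℤ)) :
    Q.comp γ = Q ↔ γ ∈ MulAction.stabilizer SL(2, ℤ) (Q.cmPoint hQ) := by
  rw [MulAction.mem_stabilizer_iff]
  have hD : (0 : ℝ) < Q.negDisc := by exact_mod_cast hQ.2
  have hs := (Real.sqrt_pos.2 hD).ne'
  constructor
  · intro h
    have h1 := atPoint_comp_div_sqrt Q hQ γ (Q.cmPoint hQ)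
    rw [h, atPoint_div_sqrt Q hQ, dist_self, Real.cosh_zero] at h1
    by_contra hne
    exact (one_lt_cosh_dist hne).ne h1
  · intro h
    refine eq_of_atPoint_eq fun z => ?_
    have h1 := atPoint_comp_div_sqrt Q hQ γ z
    have h2 := dist_smul_modular γ z (Q.cmPoint hQ)
    rw [h] at h2
    rw [h2, ← atPoint_div_sqrt Q hQ] at h1
    exact (div_left_inj' hs).1 h1

/-- A matrix that carries `Q` to a given form of its class. -/
def transporter (Q : BinForm) (P : Q.equivClass) : SL(2, ℤ) := P.2.choose

theorem comp_transporter (Q : BinForm) (P : Q.equivClass) : Q.comp (Q.transporter P) = P :=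
  P.2.choose_spec

/-- `SL₂(ℤ)` as the product of the class of `Q` and the stabilizer of its root. -/
def classProdStabilizerEquiv (Q : BinForm) (hQ : Q.PosDef) :
    Q.equivClass × MulAction.stabilizer SL(2, ℤ) (Q.cmPoint hQ) ≃ SL(2, ℤ) :=
  Equiv.ofBijective (fun x => (x.2 : SL(2, ℤ)) * Q.transporter x.1) <| by
    constructor
    · rintro ⟨P, s, hs⟩ ⟨P', s', hs'⟩ h
      simp only at h
      have hP : P = P' := by
        have h1 := congrArg Q.comp h
        rw [← comp_comp, ← comp_comp, (comp_eq_self_iff Q hQ s).2 hs,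
          (comp_eq_self_iff Q hQ s').2 hs', comp_transporter, comp_transporter] at h1
        exact Subtype.ext h1
      subst hP
      have := mul_right_cancel h
      subst this
      rfl
    · intro γ
      set P : Q.equivClass := ⟨Q.comp γ, γ, rfl⟩ with hP
      refine ⟨⟨P, γ * (Q.transporter P)⁻¹, ?_⟩, ?_⟩
      · rw [← comp_eq_self_iff Q hQ, ← comp_comp]
        have : Q.comp γ = Q.comp (Q.transporter P) := (comp_transporter Q P).symm
        rw [this, comp_comp, mul_inv_cancel, comp_one]
      · simp

theorem comp_classProdStabilizerEquiv (Q : BinForm) (hQ : Q.PosDef)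
    (x : Q.equivClass × MulAction.stabilizer SL(2, ℤ) (Q.cmPoint hQ)) :
    Q.comp (Q.classProdStabilizerEquiv hQ x) = x.1 := by
  change Q.comp ((x.2 : SL(2, ℤ)) * Q.transporter x.1) = x.1
  rw [← comp_comp, (comp_eq_self_iff Q hQ x.2).2 x.2.2, comp_transporter]

theorem summable_equivClass (Q : BinForm) {f : BinForm → ℂ}
    (hf : Summable fun γ => f (Q.comp γ)) : Summable fun P : Q.equivClass => f P := by
  have hinj : Function.Injective Q.transporter := fun P P' h => by
    apply Subtype.ext
    rw [← comp_transporter, h, comp_transporter]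
  refine (hf.comp_injective hinj).congr fun P => ?_
  simp only [Function.comp, comp_transporter]

/-- The fibres of γ ↦ Q ∘ γ are cosets of the stabilizer of τ_Q, each with 2ω elements. -/
theorem tsum_comp (Q : BinForm) (hQ : Q.PosDef) {f : BinForm → ℂ}
    (hf : Summable fun γ => f (Q.comp γ)) :
    ∑' γ, f (Q.comp γ) = 2 * omega (Q.cmPoint hQ) * ∑' P : Q.equivClass, f P := by
  have hfin : Finite (MulAction.stabilizer SL(2, ℤ) (Q.cmPoint hQ)) :=
    (finite_stabilizer _).to_subtype
  have hs := (Q.classProdStabilizerEquiv hQ).summable_iff.2 hf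
  rw [← (Q.classProdStabilizerEquiv hQ).tsum_eq]
  simp only [Function.comp_def, comp_classProdStabilizerEquiv] at hs ⊢
  rw [hs.tsum_prod, ← tsum_mul_left]
  congr 1
  ext P
  change ∑' _ : MulAction.stabilizer SL(2, ℤ) (Q.cmPoint hQ), f P = _
  rw [tsum_const, card_stabilizer, nsmul_eq_mul]
  push_cast
  rfl

theorem modularLinearForm_eq_quadHeight (Q : BinForm) (hQ : Q.PosDef) (γ : SL(2, ℤ)) {z : ℂ}
    (hz : 0 < z.im) :
    modularLinearForm γ (heightTensor z (Q.cmPoint hQ)) =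
      quadHeight ((Q.comp γ).a / √(Q.negDisc : ℝ)) ((Q.comp γ).b / √(Q.negDisc : ℝ))
        ((Q.comp γ).c / √(Q.negDisc : ℝ)) z := by
  have h1 := modularLinearForm_heightTensor γ ⟨z, hz⟩ (Q.cmPoint hQ)
  rw [← atPoint_comp_div_sqrt] at h1
  have hn : ‖z‖ ^ 2 = z.re ^ 2 + z.im ^ 2 := by
    rw [← Complex.normSq_eq_norm_sq, Complex.normSq_apply]
    ring
  rw [show modularLinearForm γ (heightTensor z (Q.cmPoint hQ)) = _ from h1, atPoint, quadHeight]
  change z.im⁻¹ * (_ * ‖z‖ ^ 2 + _ * z.re + _) / _ = _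
  rw [hn]
  ring

end BinForm

/-! ### Raising the Green's function -/

theorem raiseIter_neg (κ : ℤ) (n : ℕ) (F : ℂ → ℂ) :
    raiseIter κ n (fun u => -F u) = fun u => -raiseIter κ n F u := by
  induction n with
  | zero => rfl
  | succ n ih =>
    ext z
    simp only [raiseIter, ih, raise_eq]
    rw [fderiv_fun_neg, map_neg]
    ring

/-- Conjugation turns `quadRaise` into -P(z,1)/(√D y²). Its sign (-1)^n cancels the one in
`legendreQ_self`. -/
theorem conj_raiseIter_term {n : ℕ} {D : ℝ} (P : BinForm) {z : ℍ}
    (h : 1 < quadHeight (P.a / √D) (P.b / √D) (P.c / √D) z) :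
    starRingEnd ℂ (raiseIter 0 n (fun y =>
      ((legendreQ n 0 (quadHeight (P.a / √D) (P.b / √D) (P.c / √D) y) : ℝ) : ℂ)) z) =
    2 ^ n * n.factorial * ((√D : ℂ)⁻¹) ^ n * (((z.im : ℂ) ^ 2)⁻¹) ^ n *
      (P.eval z 1 ^ n * (sinhInt n (P.atPoint z / √D) : ℂ)) := by
  have hq : quadHeight (P.a / √D) (P.b / √D) (P.c / √D) z = P.atPoint z / √D := by
    have hn : ‖(z : ℂ)‖ ^ 2 = z.re ^ 2 + z.im ^ 2 := by
      rw [← Complex.normSq_eq_norm_sq, Complex.normSq_apply]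
      change z.re * z.re + z.im * z.im = _
      ring
    rw [BinForm.atPoint, hn, quadHeight, coe_re, coe_im]
    ring
  rw [raiseIter_legendreQ_quadHeight n n ⟨z.im_pos, h⟩]
  simp only
  rw [legendreQ_self n h, hq]
  have hr : starRingEnd ℂ (quadRaise (P.a / √D) (P.b / √D) (P.c / √D) z) =
      -((√D : ℂ)⁻¹ * ((z.im : ℂ) ^ 2)⁻¹ * P.eval z 1) := by
    simp [quadRaise, BinForm.eval]
    ring
  rw [map_mul, map_pow, hr, Complex.conj_ofReal,
    neg_pow (_ * P.eval z 1)]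
  push_cast
  have h1 : ((-1 : ℂ) ^ n) * (-1) ^ n = 1 := by rw [← mul_pow]; simp
  rw [mul_pow, mul_pow]
  linear_combination (2 ^ n * n.factorial * ((√D : ℂ)⁻¹) ^ n * (((z.im : ℂ) ^ 2)⁻¹) ^ n *
      (P.eval z 1 ^ n * (sinhInt n (P.atPoint z / √D) : ℂ))) * h1

theorem calGTerm_eq (n : ℕ) (D : ℤ) (z : ℍ) (P : BinForm) :
    calGTerm (n + 1) D z P = P.eval z 1 ^ n * (sinhInt n (P.atPoint z / √(D : ℝ)) : ℂ) := by
  rw [calGTerm, sinhInt, inv_div, Nat.add_sub_cancel, show 2 * (n + 1) - 2 = 2 * n by omega]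

/-- Raising passes through the sum. Convergence of 𝒢_Q needs no estimate of its own: its terms are
those of the raised series up to conjugation and the nonzero constant c. -/
theorem summable_calGTerm_and_conj_raiseIter {n : ℕ} (hn : 1 ≤ n) (Q : BinForm) (hQ : Q.PosDef) {z : ℍ}
    (hz : ¬ OrbitEquiv z (Q.cmPoint hQ)) :
    Summable (fun γ : SL(2, ℤ) => calGTerm (n + 1) Q.negDisc z (Q.comp γ)) ∧
    starRingEnd ℂ (raiseIter 0 n (fun u : ℂ =>
      (greenSeries n (ofComplex u) (Q.cmPoint hQ) : ℂ)) z) =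
      -(2 ^ n * n.factorial * ((√(Q.negDisc : ℝ) : ℂ)⁻¹) ^ n * (((z.im : ℂ) ^ 2)⁻¹) ^ n *
        ∑' γ : SL(2, ℤ), calGTerm (n + 1) Q.negDisc z (Q.comp γ)) := by
  set w := Q.cmPoint hQ with hw
  have hD : (0 : ℝ) < Q.negDisc := by exact_mod_cast hQ.2
  have hopen := isOpen_inequivSlice w
  have hzs := coe_mem_inequivSlice hz
  have hpos : ∀ u ∈ inequivSlice w, 0 < u.im := fun u hu => hu.1
  have hs := (summableSmoothOn_slice hn w).clm_comp hopen Complex.ofRealCLM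
  have hR := hs.raiseIter hopen hpos 0 n
  set c : ℂ := 2 ^ n * n.factorial * ((√(Q.negDisc : ℝ) : ℂ)⁻¹) ^ n *
    (((z.im : ℂ) ^ 2)⁻¹) ^ n with hc
  have hc0 : c ≠ 0 := by
    have h1 : (√(Q.negDisc : ℝ) : ℂ) ≠ 0 := by exact_mod_cast (Real.sqrt_pos.2 hD).ne'
    have h2 : (z.im : ℂ) ≠ 0 := by exact_mod_cast z.im_ne_zero
    have h3 : (n.factorial : ℂ) ≠ 0 := by exact_mod_cast n.factorial_ne_zero
    exact mul_ne_zero (mul_ne_zero (mul_ne_zero (pow_ne_zero _ two_ne_zero) h3)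
      (pow_ne_zero _ (inv_ne_zero h1))) (pow_ne_zero _ (inv_ne_zero (pow_ne_zero _ h2)))
  have hterm : ∀ γ : SL(2, ℤ), starRingEnd ℂ (raiseIter 0 n (fun u : ℂ =>
      Complex.ofRealCLM (legendreQ n 0 (modularLinearForm γ (heightTensor u w)))) z) =
      c * calGTerm (n + 1) Q.negDisc z (Q.comp γ) := fun γ => by
    have h1 := one_lt_modularLinearForm hzs γ
    rw [BinForm.modularLinearForm_eq_quadHeight Q hQ γ z.im_pos] at h1
    rw [calGTerm_eq, ← conj_raiseIter_term (Q.comp γ) h1]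
    congr 1
    refine raiseIter_congr isOpen_im_pos (fun u hu => ?_) z.im_pos
    have hu : 0 < u.im := hu
    simp only [Complex.ofRealCLM_apply]
    rw [BinForm.modularLinearForm_eq_quadHeight Q hQ γ hu]
  have hsumR : Summable fun γ : SL(2, ℤ) => starRingEnd ℂ (raiseIter 0 n (fun u : ℂ =>
      Complex.ofRealCLM (legendreQ n 0 (modularLinearForm γ (heightTensor u w)))) z) :=
    (Complex.conjCLE : ℂ →L[ℝ] ℂ).summable (hR.summable hzs)
  simp only [hterm] at hsumR
  refine ⟨(summable_mul_left_iff hc0).1 hsumR, ?_⟩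
  have e1 : Set.EqOn (fun u : ℂ => (greenSeries n (ofComplex u) w : ℂ))
      (fun u : ℂ => -∑' γ, Complex.ofRealCLM
        (legendreQ n 0 (modularLinearForm γ (heightTensor u w)))) (inequivSlice w) := fun u hu => by
    simp only [greenSeries_slice n w hu.1, Complex.ofRealCLM_apply]
    push_cast
    rfl
  rw [raiseIter_congr hopen e1 hzs, raiseIter_neg]
  simp only
  rw [raiseIter_tsum hopen hpos hs 0 n hzs, map_neg, ← tsum_mul_left, Complex.conj_tsum]
  simp only [hterm]

theorem negDisc_rpow (n : ℕ) {D : ℝ} (hD : 0 < D) :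
    D ^ ((1 - ((n + 1 : ℕ) : ℝ)) / 2) = (√D)⁻¹ ^ n := by
  rw [show (1 - ((n + 1 : ℕ) : ℝ)) / 2 = (-(1 / 2)) * n by push_cast; ring,
    Real.rpow_mul hD.le, Real.rpow_natCast, Real.rpow_neg hD.le, ← Real.sqrt_eq_rpow]

end HigherGreen
end

/-! ### The proposition -/

theorem proposition6p4 (k : ℕ) (hk : 2 ≤ k) :
    (∃ G : ℍ → ℍ → ℝ, HigherGreen.IsHigherGreen k G) ∧
    ∀ G : ℍ → ℍ → ℝ, HigherGreen.IsHigherGreen k G →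
      ∀ (Q : HigherGreen.BinForm) (hQ : Q.PosDef) (z : ℍ),
        ¬ HigherGreen.OrbitEquiv z (Q.cmPoint hQ) →
        Summable (fun P : Q.equivClass => HigherGreen.calGTerm k Q.negDisc z P) ∧
        HigherGreen.calG k Q z =
          -(1 / (2 ^ k * (HigherGreen.omega (Q.cmPoint hQ) : ℂ) * ((k - 1).factorial : ℂ))) *
            (z.im : ℂ) ^ (2 * k - 2) *
            starRingEnd ℂ (HigherGreen.raiseIter 0 (k - 1)
              (fun w : ℂ => (G (ofComplex w) (Q.cmPoint hQ) : ℂ)) (z : ℂ)) := by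
  obtain ⟨n, rfl⟩ : ∃ n, k = n + 1 := ⟨k - 1, by omega⟩
  have hn : 1 ≤ n := by omega
  have hG := HigherGreen.isHigherGreen_greenSeries hn
  refine ⟨⟨_, hG⟩, fun G hG' Q hQ z hz => ?_⟩
  obtain ⟨hsum, hraise⟩ := HigherGreen.summable_calGTerm_and_conj_raiseIter hn Q hQ hz
  refine ⟨Q.summable_equivClass (f := HigherGreen.calGTerm (n + 1) Q.negDisc z) hsum, ?_⟩
  have hopen := HigherGreen.isOpen_inequivSlice (Q.cmPoint hQ)
  -- Uniqueness identifies G with the Poincaré series on an open set, which suffices because raising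
  -- depends only on germs.
  have he : Set.EqOn (fun w : ℂ => (G (ofComplex w) (Q.cmPoint hQ) : ℂ))
      (fun w : ℂ => (HigherGreen.greenSeries n (ofComplex w) (Q.cmPoint hQ) : ℂ))
      (HigherGreen.inequivSlice (Q.cmPoint hQ)) := fun u hu => by
    simp only [hG'.unique hk hG hu.2]
  rw [Nat.add_sub_cancel, HigherGreen.raiseIter_congr hopen he (HigherGreen.coe_mem_inequivSlice hz),
    hraise, Q.tsum_comp hQ (f := HigherGreen.calGTerm (n + 1) Q.negDisc z) hsum]
  have hD : (0 : ℝ) < Q.negDisc := by exact_mod_cast hQ.2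
  rw [HigherGreen.calG, HigherGreen.negDisc_rpow n hD, show 2 * (n + 1) - 2 = 2 * n by omega]
  have h1 : (√(Q.negDisc : ℝ) : ℂ) ≠ 0 := by exact_mod_cast (Real.sqrt_pos.2 hD).ne'
  have h2 : (z.im : ℂ) ≠ 0 := by exact_mod_cast z.im_ne_zero
  have h3 : (n.factorial : ℂ) ≠ 0 := by exact_mod_cast n.factorial_ne_zero
  have h4 : (HigherGreen.omega (Q.cmPoint hQ) : ℂ) ≠ 0 := by
    exact_mod_cast (HigherGreen.omega_pos _).ne'
  push_cast
  rw [pow_mul, inv_pow, inv_pow, pow_succ]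
  field_simp
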